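/- Let $k$ be an algebraically closed field of characteristic $p>0$, let $n,a$ be integers with $1\le a\le n-1$, $\gcd(a,n)=1$ and $n$ coprime to $p$, let $\zeta\in k$ be a primitive $n$-th root of unity, and let $G=\frac1n(1,a)$ be the cyclic group generated by $\sigma=\operatorname{diag}(\zeta,\zeta^a)$, acting on $S=k[[x,y]]$ by $\sigma x=\zeta x$, $\sigma y=\zeta^a y$. Put $R=S^G$ and, for $0\le s\le n-1$, $M_s=\{f\in S\mid \sigma f=\zeta^s f\}$ (these $R$-modules, with $M_0=R$, are the indecomposable maximal Cohen–Macaulay $R$-modules up to isomorphism). Let $\omega_R=(S\,dx\wedge dy)^G=\{f\in S\mid \zeta^{1+a}\sigma f=f\}$ be the canonical module. A maximal Cohen–Macaulay $R$-module $M$ is called special if $(M\otimes_R\omega_R)/\mathrm{torsion}$ is also maximal Cohen–Macaulay. Write $\frac na=[\alpha_1,\dots,\alpha_r]=\alpha_1-\cfrac{1}{\alpha_2-\cfrac{1}{\alpha_3-\cdots}}$ with integers $\alpha_i\ge2$ (the Hirzebruch–Jung continued fraction), and set $$i_0=n,\quad i_1=a,\quad i_t=\alpha_{t-1}i_{t-1}-i_{t-2},\qquad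 j_0=0,\quad j_1=1,\quad j_t=\alpha_{t-1}j_{t-1}-j_{t-2}\qquad(2\le t\le r+1).$$ For a finitely generated $R$-module $M$ and $e\ge0$, let ${}^eM$ be the abelian group $M$ with $R$-action $r\cdot m=r^{p^e}m$, and let $b_e(M)$ be the largest integer $m$ such that there is a surjective $R$-linear map ${}^eM\to M^{\oplus m}$. The dual $F$-signature of $M$ is $s(M)=\lim_{e\to\infty}b_e(M)/p^{e\dim R}$, if this limit exists. Then the non-free special modules among $M_0,\dots,M_{n-1}$ are exactly $M_{i_1},\dots,M_{i_r}$. For $1\le t\le r$ the module $M_{i_t}$ is indecomposable, $M_{i_t}=Rx^{i_t}+Ry^{j_t}$, its dual $F$-signature exists, and $$s(M_{i_t})=\begin{cases}\dfrac{\min(i_t,j_t)+1}{n}&\text{if } i_t\ne j_t,\\[2mm] \dfrac{2i_t+1}{2n}&\text{if } i_t=j_t.\end{cases}$$ -/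

import Mathlib

open scoped TensorProduct

noncomputable section

namespace DualFSig

/-! ### Frobenius push-forward and dual F-signature -/

/-- The module `ᵉM`: the abelian group `M`, on which `r : R` acts as `r ^ (p ^ e)`. -/
def FrobTwist (_p _e : ℕ) (M : Type*) : Type _ := M

instance (p e : ℕ) (M : Type*) [AddCommGroup M] : AddCommGroup (FrobTwist p e M) :=
  inferInstanceAs (AddCommGroup M)

instance (R : Type*) [CommRing R] (p e : ℕ) [ExpChar R p] (M : Type*) [AddCommGroup M]
    [Module R M] : Module R (FrobTwist p e M) :=
  Module.compHom M (iterateFrobenius R p e)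

/-- The action on `ᵉM` is `r • m = r ^ (p ^ e) m`. -/
theorem frobTwist_smul_def (R : Type*) [CommRing R] (p e : ℕ) [ExpChar R p] (M : Type*)
    [AddCommGroup M] [Module R M] (r : R) (m : M) :
    (show M from r • (show FrobTwist p e M from m)) = r ^ (p ^ e) • m := rfl

/-- `b` is the `e`-th F-surjective number of `M`: the largest `m` for which there is an
`R`-linear surjection from `ᵉM` onto `M ^ m`. -/
def IsFSurjectiveNumber (R : Type*) [CommRing R] (p : ℕ) [ExpChar R p] (M : Type*)
    [AddCommGroup M] [Module R M] (e b : ℕ) : Prop :=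
  IsGreatest {m : ℕ | ∃ φ : FrobTwist p e M →ₗ[R] (Fin m → M), Function.Surjective φ} b

/-- The dual F-signature of `M` exists and is equal to `s`: with `d = dim R` and `b e` the
`e`-th F-surjective number of `M`, the sequence `b e / p ^ (e d)` converges to `s`. -/
def HasDualFSignature (R : Type*) [CommRing R] (p : ℕ) [ExpChar R p] (M : Type*)
    [AddCommGroup M] [Module R M] (s : ℝ) : Prop :=
  ∃ (d : ℕ) (b : ℕ → ℕ), ringKrullDim R = (d : WithBot ℕ∞) ∧
    (∀ e, IsFSurjectiveNumber R p M e (b e)) ∧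
    Filter.Tendsto (fun e : ℕ => (b e : ℝ) / (p : ℝ) ^ (e * d)) Filter.atTop (nhds s)

/-! ### Maximal Cohen-Macaulay, special and indecomposable modules -/

/-- `M` is a maximal Cohen-Macaulay module over the local ring `R`: it is finitely generated
and has a regular sequence in the maximal ideal whose length is the dimension of `R`. -/
def IsMCM (R : Type*) [CommRing R] [IsLocalRing R] (M : Type*) [AddCommGroup M] [Module R M] :
    Prop :=
  Module.Finite R M ∧ ∃ rs : List R, (∀ r ∈ rs, r ∈ IsLocalRing.maximalIdeal R) ∧
    RingTheory.Sequence.IsRegular M rs ∧ ringKrullDim R = (rs.length : WithBot ℕ∞)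

/-- `M` is special (with respect to the canonical module `W`): `M` is maximal Cohen-Macaulay and
`M ⊗ W` modulo torsion is maximal Cohen-Macaulay. -/
def IsSpecial (R : Type*) [CommRing R] [IsLocalRing R] (W : Type*) [AddCommGroup W] [Module R W]
    (M : Type*) [AddCommGroup M] [Module R M] : Prop :=
  IsMCM R M ∧ IsMCM R ((M ⊗[R] W) ⧸ Submodule.torsion R (M ⊗[R] W))

/-- `M` is nonzero and is not the direct sum of two nonzero submodules. -/
def IsIndecomposable (R : Type*) [CommRing R] (M : Type*) [AddCommGroup M] [Module R M] : Prop :=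
  Nontrivial M ∧ ∀ A B : Submodule R M, IsCompl A B → A = ⊥ ∨ B = ⊥

/-! ### The invariant ring of the cyclic group `(1/n)(1,a)` and its semi-invariants -/

section Cyclic

variable {k : Type*} [Field k]

/-- The power series ring `k[[x,y]]`; `x` and `y` are `MvPowerSeries.X 0` and
`MvPowerSeries.X 1`. -/
abbrev PS (k : Type*) [Field k] : Type _ := MvPowerSeries (Fin 2) k

/-- The action on `k[[x,y]]` of the generator `σ = diag(ζ, ζ ^ a)`: `x ↦ ζ x`, `y ↦ ζ ^ a y`. -/
def sigma (ζ : k) (a : ℕ) : PS k →ₐ[k] PS k :=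
  MvPowerSeries.rescaleAlgHom ![ζ, ζ ^ a]

/-- The invariant ring `R = k[[x,y]]^G`, where `G` is the cyclic group generated by `σ`
(a power series is fixed by `G` if and only if it is fixed by `σ`). -/
def invRing (ζ : k) (a : ℕ) : Subalgebra k (PS k) :=
  AlgHom.equalizer (sigma ζ a) (AlgHom.id k (PS k))

theorem mem_invRing {ζ : k} {a : ℕ} {f : PS k} : f ∈ invRing ζ a ↔ sigma ζ a f = f := Iff.rfl

instance (ζ : k) (a : ℕ) : IsLocalRing (invRing ζ a) := by
  have key : ∀ f : invRing ζ a, IsUnit (f : PS k) → IsUnit f := by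
    rintro ⟨f, hf⟩ ⟨u, hu⟩
    have hu' : (u : PS k) = f := hu
    have hf' : sigma ζ a f = f := hf
    have h1 : f * (↑u⁻¹ : PS k) = 1 := by rw [← hu']; exact u.mul_inv
    have h3 : f * sigma ζ a (↑u⁻¹ : PS k) = 1 := by
      have h := congrArg (sigma ζ a) h1
      rwa [map_mul, map_one, hf'] at h
    have h2 : sigma ζ a (↑u⁻¹ : PS k) = ↑u⁻¹ := by
      calc sigma ζ a (↑u⁻¹ : PS k) = (f * ↑u⁻¹) * sigma ζ a (↑u⁻¹ : PS k) := by rw [h1, one_mul]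
        _ = (f * sigma ζ a (↑u⁻¹ : PS k)) * ↑u⁻¹ := by ring
        _ = ↑u⁻¹ := by rw [h3, one_mul]
    exact IsUnit.of_mul_eq_one (⟨(↑u⁻¹ : PS k), h2⟩ : invRing ζ a) (Subtype.ext h1)
  refine IsLocalRing.of_isUnit_or_isUnit_one_sub_self fun f => ?_
  rcases IsLocalRing.isUnit_or_isUnit_one_sub_self (f : PS k) with h | h
  · exact Or.inl (key f h)
  · exact Or.inr (key (1 - f) (by simpa using h))

instance (ζ : k) (a p : ℕ) [Fact p.Prime] [CharP k p] : ExpChar (invRing ζ a) p :=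
  expChar_of_injective_algebraMap (algebraMap k (invRing ζ a)).injective p

/-- The `R`-module `M_s = {f | σ f = ζ ^ s f} = (S ⊗ V_s)^G`; it consists of the power series in
the monomials `x ^ u y ^ v` with `u + a v ≡ s` modulo the order of `ζ`. -/
def semiInv (ζ : k) (a s : ℕ) : Submodule (invRing ζ a) (PS k) where
  carrier := {f | sigma ζ a f = ζ ^ s • f}
  add_mem' := by
    intro f g hf hg
    simp only [Set.mem_ofPred_eq] at *
    rw [map_add, hf, hg, smul_add]
  zero_mem' := by simp
  smul_mem' := by
    rintro ⟨r, hr⟩ f hf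
    have hr' : sigma ζ a r = r := hr
    have hf' : sigma ζ a f = ζ ^ s • f := hf
    change sigma ζ a (r * f) = ζ ^ s • (r * f)
    rw [map_mul, hr', hf', mul_smul_comm]

/-- The canonical module `ω_R = (S dx ∧ dy)^G` of `R`: the power series `f` for which the
2-form `f dx ∧ dy` is invariant. As `σ (dx ∧ dy) = ζ ^ (1 + a) dx ∧ dy`, the condition is
`ζ ^ (1 + a) σ f = f`. -/
def canonicalModule (ζ : k) (a : ℕ) : Submodule (invRing ζ a) (PS k) where
  carrier := {f | ζ ^ (1 + a) • sigma ζ a f = f}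
  add_mem' := by
    intro f g hf hg
    simp only [Set.mem_ofPred_eq] at *
    rw [map_add, smul_add, hf, hg]
  zero_mem' := by simp
  smul_mem' := by
    rintro ⟨r, hr⟩ f hf
    have hr' : sigma ζ a r = r := hr
    have hf' : ζ ^ (1 + a) • sigma ζ a f = f := hf
    change ζ ^ (1 + a) • sigma ζ a (r * f) = r * f
    rw [map_mul, hr', ← mul_smul_comm, hf']

end Cyclic

/-! ### Hirzebruch-Jung continued fractions, the `i`-series and the `j`-series -/

/-- `[α₁, …, α_r] = α₁ - 1 / (α₂ - 1 / (α₃ - ⋯))`. -/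
def hjEval : List ℕ → ℚ
  | [] => 0
  | [c] => c
  | c :: d :: l => c - 1 / hjEval (d :: l)

/-- `α = [α₁, …, α_r]` is the Hirzebruch-Jung continued fraction expansion of `n / a`. -/
def IsHJExpansion (n a : ℕ) (α : List ℕ) : Prop :=
  (∀ c ∈ α, 2 ≤ c) ∧ (n : ℚ) / a = hjEval α

/-- The `i`-series: `i₀ = n`, `i₁ = a`, `i_t = α_{t-1} i_{t-1} - i_{t-2}`. The entry `α_{t+1}` of
the expansion is `α.getD t 0`, as lists are indexed from `0`. -/
def iSeries (n a : ℕ) (α : List ℕ) : ℕ → ℤ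
  | 0 => n
  | 1 => a
  | t + 2 => (α.getD t 0 : ℤ) * iSeries n a α (t + 1) - iSeries n a α t

/-- The `j`-series: `j₀ = 0`, `j₁ = 1`, `j_t = α_{t-1} j_{t-1} - j_{t-2}`. -/
def jSeries (α : List ℕ) : ℕ → ℤ
  | 0 => 0
  | 1 => 1
  | t + 2 => (α.getD t 0 : ℤ) * jSeries α (t + 1) - jSeries α t

end DualFSig

end

/-! Everything is graded by weight: M_s consists of the power series in the monomials x^u y^v with u
+ a v ≡ s mod n, so the assertions about modules become assertions about lattice points. Write q =
p^e, and (i, j) = (i_t, j_t).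

Classification. M_s ⊗ ω modulo torsion is the product M_s ω inside S, a submodule of M_{s-1-a}
(`torsion_eq_ker_mulMap`). Powers of x^n and y^n multiply M_{s-1-a} into it, so it is maximal
Cohen–Macaulay exactly when it is everything. On monomials this gives a descent, which ends with the
statement that no monomial of weight s lies in the box [0, s) × [0, j), where j is least with a j ≡
s. Consecutive points (i_t, j_t) form a basis of the lattice u ≡ a w mod n, and i_t decreases while
j_t increases; hence these boxes are empty, and an empty box occurs only for s = i_t
(`jSeries_succ_le`, `exists_iSeries_eq`).

Upper bound. An R-linear map from ᵉM_i to M_i sends multiples of x^{uq} to multiples of x^u, and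
likewise for y (`X_pow_dvd_map_toTwist`). The coefficient of x^i in an image therefore depends only
on the box [0, (i+1)q) × [0, q), which has about (i+1)q²/n exponents of weight i; so m ≤ (i+1)q²/n
up to O(q), and similarly with j. Reading x^i and y^j together costs the union of two boxes and
gives 2m ≤ (i+j+1)q²/n up to O(q), which is sharper exactly when i = j.

Lower bound. S is free over its q-th powers on the monomials with exponents in [0, q)², so ᵉM_i
splits into pieces of the form M_t. About q²/n pieces are copies of M_i. Any other copy is covered
by two pieces, one mapping onto R x^i and one onto R y^j; the empty box shows when the two pieces
differ. The pieces indexed by the square [0, q)² can serve either purpose: they go to the smaller of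
i, j, or are halved when i = j (`exists_surjective_of_sources`). -/

noncomputable section
namespace DualFSig
open MvPowerSeries

/-! ### Semi-invariants as power series of a given weight -/

section Weights
variable {k : Type*} [Field k]

/-- All monomials `x ^ u y ^ v` of `f` satisfy `u + a v ≡ s` modulo `n`. -/
def HasWt (n a s : ℕ) (f : PS k) : Prop :=
  ∀ m : Fin 2 →₀ ℕ, coeff m f ≠ 0 → m 0 + a * m 1 ≡ s [MOD n]

theorem coeff_sigma (ζ : k) (a : ℕ) (f : PS k) (m : Fin 2 →₀ ℕ) :
    coeff m (sigma ζ a f) = ζ ^ (m 0 + a * m 1) * coeff m f := by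
  rw [sigma, rescaleAlgHom_apply, coeff_rescale, Finsupp.prod_fintype _ _ (by simp)]
  simp [Fin.prod_univ_two, pow_add, pow_mul]

/-- σ multiplies the coefficient at (u, v) by ζ^(u + a v), and powers of ζ agree exactly when their
exponents agree modulo n. -/
theorem sigma_eq_smul_iff {ζ : k} {n : ℕ} [NeZero n] (hζ : IsPrimitiveRoot ζ n) (a s : ℕ) (f : PS k) :
    sigma ζ a f = ζ ^ s • f ↔ HasWt n a s f := by
  constructor
  · intro h m hm
    have h1 := congrArg (coeff m) h
    rw [coeff_sigma, coeff_smul] at h1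
    have h2 := mul_right_cancel₀ hm h1
    rwa [IsOfFinOrder.pow_eq_pow_iff_modEq (hζ.isOfFinOrder (NeZero.ne n)), ← hζ.eq_orderOf] at h2
  · intro h
    ext m
    rw [coeff_sigma, coeff_smul]
    by_cases hm : coeff m f = 0
    · simp [hm]
    · have := h m hm
      rw [hζ.eq_orderOf,
        ← IsOfFinOrder.pow_eq_pow_iff_modEq (hζ.isOfFinOrder (NeZero.ne n))] at this
      rw [this]

theorem mem_semiInv_iff {ζ : k} {n : ℕ} [NeZero n] (hζ : IsPrimitiveRoot ζ n) {a s : ℕ} {f : PS k} :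
    f ∈ semiInv ζ a s ↔ HasWt n a s f := sigma_eq_smul_iff hζ a s f

theorem mem_invRing_iff {ζ : k} {n : ℕ} [NeZero n] (hζ : IsPrimitiveRoot ζ n) {a : ℕ} {f : PS k} :
    f ∈ invRing ζ a ↔ HasWt n a 0 f := by
  rw [← sigma_eq_smul_iff hζ a 0 f, mem_invRing, pow_zero, one_smul]

/-- The natural number (1 + a)(n - 1) represents the weight -(1 + a). -/
theorem canonicalModule_eq {ζ : k} {n : ℕ} [NeZero n] (hζ : IsPrimitiveRoot ζ n) (a : ℕ) :
    canonicalModule ζ a = semiInv ζ a ((1 + a) * (n - 1)) := by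
  have key : ζ ^ (1 + a) * ζ ^ ((1 + a) * (n - 1)) = 1 := by
    rw [← pow_add, show (1 + a) + (1 + a) * (n - 1) = n * (1 + a) by
      obtain ⟨m, hm⟩ := Nat.exists_eq_add_of_le (NeZero.one_le (n := n)); rw [hm]; simp; ring, pow_mul, hζ.pow_eq_one, one_pow]
  ext f
  change ζ ^ (1 + a) • sigma ζ a f = f ↔ sigma ζ a f = ζ ^ ((1 + a) * (n - 1)) • f
  constructor
  · intro h
    conv_rhs => rw [← h, smul_smul, mul_comm, key, one_smul]
  · intro h
    rw [h, smul_smul, key, one_smul]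

namespace HasWt
variable {n a s t : ℕ} {f g : PS k}

theorem zero : HasWt n a s (0 : PS k) := fun m hm => absurd (coeff_zero m) hm

theorem add (hf : HasWt n a s f) (hg : HasWt n a s g) : HasWt n a s (f + g) := by
  intro m hm
  by_cases h : coeff m f = 0
  · exact hg m (by simpa [h] using hm)
  · exact hf m h

theorem sum {ι : Type*} {T : Finset ι} {F : ι → PS k} (h : ∀ i ∈ T, HasWt n a s (F i)) :
    HasWt n a s (∑ i ∈ T, F i) := by
  classical
  induction T using Finset.induction_on with
  | empty => simpa using zero
  | insert i T hi ih =>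
    rw [Finset.sum_insert hi]
    exact (h i (by simp)).add (ih fun j hj => h j (by simp [hj]))

theorem mul (hf : HasWt n a s f) (hg : HasWt n a t g) : HasWt n a (s + t) (f * g) := by
  classical
  intro m hm
  rw [MvPowerSeries.coeff_mul] at hm
  obtain ⟨⟨u, v⟩, huv, h⟩ := Finset.exists_ne_zero_of_sum_ne_zero hm
  rw [Finset.HasAntidiagonal.mem_antidiagonal] at huv
  have h1 := hf u (left_ne_zero_of_mul h)
  have h2 := hg v (right_ne_zero_of_mul h)
  have := h1.add h2
  rw [← huv]
  simp only [Finsupp.add_apply]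
  convert this using 1
  ring

theorem congr (hf : HasWt n a s f) (h : s ≡ t [MOD n]) : HasWt n a t f :=
  fun m hm => (hf m hm).trans h

theorem monomial (u v : ℕ) : HasWt n a (u + a * v) (X 0 ^ u * X 1 ^ v : PS k) := by
  classical
  intro m hm
  rw [X_pow_eq, X_pow_eq, monomial_mul_monomial, coeff_monomial] at hm
  split_ifs at hm with h
  · subst h; simp [Nat.ModEq]
  · exact absurd rfl hm

theorem X0_pow (u : ℕ) : HasWt n a u (X 0 ^ u : PS k) := by simpa using monomial (k := k) (n := n) (a := a) u 0

theorem X1_pow (v : ℕ) : HasWt n a (a * v) (X 1 ^ v : PS k) := by simpa using monomial (k := k) (n := n) (a := a) 0 v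

theorem one : HasWt n a 0 (1 : PS k) := by simpa using X0_pow (k := k) (n := n) (a := a) 0

theorem pow (hf : HasWt n a s f) (e : ℕ) : HasWt n a (e * s) (f ^ e) := by
  induction e with
  | zero => simpa using one
  | succ e ih => rw [pow_succ]; exact (ih.mul hf).congr (by rw [add_mul, one_mul])

/-- Weights can be cancelled against monomials, so the cofactors in the decompositions below again
have a weight. -/
theorem of_X_pow_mul {i : Fin 2} {u : ℕ} (h : HasWt n a s (X i ^ u * f)) {w : ℕ}
    (hw : HasWt n a w (X i ^ u : PS k)) (ht : w + t ≡ s [MOD n]) : HasWt n a t f := by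
  intro m hm
  have h1 := h (Finsupp.single i u + m)
    (by rw [X_pow_eq, coeff_add_monomial_mul, one_mul]; exact hm)
  have h2 := hw (Finsupp.single i u) (by rw [X_pow_eq, coeff_monomial_same]; exact one_ne_zero)
  simp only [Finsupp.add_apply] at h1
  refine Nat.ModEq.add_left_cancel h2 ?_
  refine Nat.ModEq.trans ?_ (h1.trans ht.symm)
  rw [show Finsupp.single i u 0 + a * Finsupp.single i u 1 + (m 0 + a * m 1) =
    Finsupp.single i u 0 + m 0 + a * (Finsupp.single i u 1 + m 1) by ring]

theorem of_X0_pow_mul {u : ℕ} (h : HasWt n a s (X 0 ^ u * f)) (ht : u + t ≡ s [MOD n]) :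
    HasWt n a t f := h.of_X_pow_mul (X0_pow u) ht

theorem of_X1_pow_mul {u : ℕ} (h : HasWt n a s (X 1 ^ u * f)) (ht : a * u + t ≡ s [MOD n]) :
    HasWt n a t f := h.of_X_pow_mul (X1_pow u) ht

end HasWt

open Classical in
/-- The part of a power series consisting of the monomials whose exponent satisfies `P`. -/
def filt (P : (Fin 2 →₀ ℕ) → Prop) (f : PS k) : PS k := fun m => if P m then coeff m f else 0

open Classical in
theorem coeff_filt (P : (Fin 2 →₀ ℕ) → Prop) (f : PS k) (m : Fin 2 →₀ ℕ) :
    coeff m (filt P f) = if P m then coeff m f else 0 := rfl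

theorem filt_add_filt_not (P : (Fin 2 →₀ ℕ) → Prop) (f : PS k) :
    filt P f + filt (fun m => ¬ P m) f = f := by
  ext m
  rw [map_add, coeff_filt, coeff_filt]
  by_cases h : P m <;> simp [h]

theorem HasWt.filt {n a s : ℕ} {f : PS k} (hf : HasWt n a s f) (P : (Fin 2 →₀ ℕ) → Prop) :
    HasWt n a s (filt P f) := by
  intro m hm
  rw [coeff_filt] at hm
  split_ifs at hm with h
  · exact hf m hm
  · exact absurd rfl hm

theorem X_pow_dvd_filt {P : (Fin 2 →₀ ℕ) → Prop} {i : Fin 2} {u : ℕ} (h : ∀ m, P m → u ≤ m i)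
    (f : PS k) : X i ^ u ∣ filt P f := by
  rw [X_pow_dvd_iff]
  intro m hm
  rw [coeff_filt, if_neg fun hP => absurd (h m hP) (by omega)]

/-- A power series all of whose monomials are divisible by `x ^ u` or by `y ^ v` is a combination
of `x ^ u` and `y ^ v`, with summands of the same weight. -/
theorem exists_eq_add_of_support {n a s U V : ℕ} {f : PS k} (hf : HasWt n a s f)
    (h : ∀ m, coeff m f ≠ 0 → U ≤ m 0 ∨ V ≤ m 1) :
    ∃ f₁ f₂ : PS k, f = X 0 ^ U * f₁ + X 1 ^ V * f₂ ∧ HasWt n a s (X 0 ^ U * f₁) ∧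
      HasWt n a s (X 1 ^ V * f₂) := by
  obtain ⟨f₁, h₁⟩ := X_pow_dvd_filt (P := fun m => U ≤ m 0) (fun _ hm => hm) f
  have h2 : X 1 ^ V ∣ DualFSig.filt (fun m => ¬ U ≤ m 0) f := by
    rw [X_pow_dvd_iff]
    intro m hm
    rw [coeff_filt]
    split_ifs with hP
    · rfl
    · by_contra hc
      rcases h m hc with h' | h' <;> omega
  obtain ⟨f₂, h₂⟩ := h2
  refine ⟨f₁, f₂, ?_, ?_, ?_⟩
  · rw [← h₁, ← h₂, filt_add_filt_not]
  · rw [← h₁]; exact hf.filt _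
  · rw [← h₂]; exact hf.filt _

theorem X_pow_dvd_of_dvd_X_pow_mul {i j : Fin 2} (hij : i ≠ j) {u v : ℕ} {f : PS k}
    (h : X i ^ u ∣ X j ^ v * f) : X i ^ u ∣ f := by
  rw [X_pow_dvd_iff] at h ⊢
  intro m hm
  have := h (Finsupp.single j v + m) (by simp [hij.symm, hm])
  rwa [X_pow_eq, coeff_add_monomial_mul, one_mul] at this

theorem X_pow_ne_zero (i : Fin 2) (u : ℕ) : (X i ^ u : PS k) ≠ 0 := by
  rw [X_pow_eq]
  intro h
  have := congrArg (coeff (Finsupp.single i u)) h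
  rw [coeff_monomial_same, coeff_zero] at this
  exact one_ne_zero this

theorem coeff_eq_zero_of_X_pow_dvd {i : Fin 2} {u : ℕ} {f : PS k} (h : X i ^ u ∣ f)
    {m : Fin 2 →₀ ℕ} (hm : m i < u) : coeff m f = 0 := X_pow_dvd_iff.1 h m hm

end Weights

/-! ### Regular sequences of length two -/

section General
variable {R : Type*} [CommRing R] {M M' : Type*} [AddCommGroup M] [Module R M]
  [AddCommGroup M'] [Module R M']

theorem isWeaklyRegular_pair_iff (r₁ r₂ : R) :
    RingTheory.Sequence.IsWeaklyRegular M [r₁, r₂] ↔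
      (∀ f : M, r₁ • f = 0 → f = 0) ∧ ∀ f g : M, r₂ • f = r₁ • g → ∃ h, f = r₁ • h := by
  rw [RingTheory.Sequence.isWeaklyRegular_cons_iff, RingTheory.Sequence.isWeaklyRegular_singleton_iff,
    isSMulRegular_iff_right_eq_zero_of_smul, isSMulRegular_quotient_iff_mem_of_smul_mem]
  simp only [Submodule.mem_smul_pointwise_iff_exists, Submodule.mem_top, true_and]
  refine and_congr_right fun _ => forall_congr' fun f => ?_
  constructor
  · intro h g hg
    obtain ⟨b, hb⟩ := h ⟨g, hg.symm⟩
    exact ⟨b, hb.symm⟩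
  · rintro h ⟨g, hg⟩
    obtain ⟨b, hb⟩ := h g hg.symm
    exact ⟨b, hb.symm⟩

theorem IsMCM.congr [IsLocalRing R] (e : M ≃ₗ[R] M') (h : IsMCM R M) : IsMCM R M' := by
  obtain ⟨hf, rs, h1, h2, h3⟩ := h
  exact ⟨Module.Finite.equiv e, rs, h1, (e.isRegular_congr rs).1 h2, h3⟩

end General

/-! ### The invariant ring and the modules M_s -/

section Ring
variable {k : Type*} [Field k] {n a : ℕ} {ζ : k}

/-- Multiplication by an invariant preserves weights, so projecting onto one weight is R-linear. In
weight 0 this is the Reynolds operator. -/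
theorem filt_mul {r : PS k} (hr : HasWt n a 0 r) (s : ℕ) (f : PS k) :
    filt (fun m => m 0 + a * m 1 ≡ s [MOD n]) (r * f) =
      r * filt (fun m => m 0 + a * m 1 ≡ s [MOD n]) f := by
  classical
  ext m
  rw [coeff_filt, MvPowerSeries.coeff_mul, MvPowerSeries.coeff_mul]
  have key : ∀ q ∈ Finset.HasAntidiagonal.antidiagonal m, coeff q.1 r ≠ 0 →
      (q.2 0 + a * q.2 1 ≡ s [MOD n] ↔ m 0 + a * m 1 ≡ s [MOD n]) := by
    rintro ⟨u, v⟩ huv h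
    rw [Finset.HasAntidiagonal.mem_antidiagonal] at huv
    have h2 : m 0 + a * m 1 ≡ v 0 + a * v 1 [MOD n] := by
      have := (hr u h).add_right (v 0 + a * v 1)
      rw [zero_add] at this
      rw [← huv]
      simp only [Finsupp.add_apply]
      convert this using 1
      ring
    exact ⟨fun h3 => h2.trans h3, fun h3 => h2.symm.trans h3⟩
  split_ifs with hP
  · refine Finset.sum_congr rfl fun q hq => ?_
    rw [coeff_filt]
    by_cases h : coeff q.1 r = 0
    · simp [h]
    · rw [if_pos ((key q hq h).2 hP)]
  · refine (Finset.sum_eq_zero fun q hq => ?_).symm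
    rw [coeff_filt]
    by_cases h : coeff q.1 r = 0
    · simp [h]
    · rw [if_neg (mt (key q hq h).1 hP), mul_zero]

theorem hasWt_filt (s : ℕ) (f : PS k) :
    HasWt n a s (filt (fun m => m 0 + a * m 1 ≡ s [MOD n]) f) := by
  intro m hm
  rw [coeff_filt] at hm
  by_contra h
  rw [if_neg h] at hm
  exact hm rfl

theorem HasWt.filt_eq {s : ℕ} {f : PS k} (hf : HasWt n a s f) :
    DualFSig.filt (fun m => m 0 + a * m 1 ≡ s [MOD n]) f = f := by
  ext m
  rw [coeff_filt]
  by_cases h : coeff m f = 0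
  · simp [h]
  · rw [if_pos (hf m h)]

theorem filt_add (P : (Fin 2 →₀ ℕ) → Prop) (f g : PS k) :
    filt P (f + g) = filt P f + filt P g := by
  ext m
  simp only [coeff_filt, map_add]
  split_ifs <;> simp

theorem filt_zero (P : (Fin 2 →₀ ℕ) → Prop) : filt P (0 : PS k) = 0 := by
  ext m
  simp [coeff_filt]

variable [NeZero n]

theorem hasWt_coe (hζ : IsPrimitiveRoot ζ n) (r : invRing ζ a) : HasWt n a 0 (r : PS k) :=
  (mem_invRing_iff hζ).1 r.2

/-- The weight-zero part is an R-linear retraction of S onto R, hence carries I S into I. Ideals of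
R thus embed in those of S, which makes R Noetherian. -/
theorem comap_map_invRing (hζ : IsPrimitiveRoot ζ n) (I : Ideal (invRing ζ a)) :
    (I.map (algebraMap (invRing ζ a) (PS k))).comap (algebraMap (invRing ζ a) (PS k)) = I := by
  refine le_antisymm ?_ Ideal.le_comap_map
  let ρ : PS k → invRing ζ a := fun f =>
    ⟨filt (fun m => m 0 + a * m 1 ≡ 0 [MOD n]) f, (mem_invRing_iff hζ).2 (hasWt_filt 0 f)⟩
  have key : ∀ z ∈ I.map (algebraMap (invRing ζ a) (PS k)), ∀ s : PS k, ρ (z * s) ∈ I := by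
    intro z hz
    refine Submodule.span_induction (p := fun z _ => ∀ s : PS k, ρ (z * s) ∈ I) ?_ ?_ ?_ ?_ hz
    · rintro _ ⟨x, hx, rfl⟩ s
      have : ρ (algebraMap (invRing ζ a) (PS k) x * s) = x * ρ s :=
        Subtype.ext (filt_mul (hasWt_coe hζ x) 0 s)
      rw [this]
      exact I.mul_mem_right _ hx
    · intro s
      have : ρ (0 * s) = 0 := Subtype.ext (by simp only [zero_mul, ρ]; exact filt_zero _)
      rw [this]; exact I.zero_mem
    · intro x y _ _ hx hy s
      have : ρ ((x + y) * s) = ρ (x * s) + ρ (y * s) :=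
        Subtype.ext (by simp only [add_mul, ρ]; exact filt_add _ _ _)
      rw [this]; exact I.add_mem (hx s) (hy s)
    · intro c x _ hx s
      have : c • x * s = x * (c * s) := by rw [smul_eq_mul]; ring
      rw [this]; exact hx _
  intro x hx
  have h1 := key _ hx 1
  have : ρ (algebraMap (invRing ζ a) (PS k) x * 1) = x := by
    rw [mul_one]; exact Subtype.ext (hasWt_coe hζ x).filt_eq
  rwa [this] at h1

theorem isNoetherianRing_invRing (hζ : IsPrimitiveRoot ζ n) : IsNoetherianRing (invRing ζ a) := by
  have hinj : StrictMono (fun I : Ideal (invRing ζ a) => I.map (algebraMap (invRing ζ a) (PS k))) :=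
    Monotone.strictMono_of_injective (fun I J h => Ideal.map_mono h) fun I J h => by
      have := congrArg (Ideal.comap (algebraMap (invRing ζ a) (PS k))) h
      simpa only [comap_map_invRing hζ] using this
  rw [isNoetherianRing_iff, isNoetherian_iff']
  exact hinj.wellFoundedGT

/-- The weight-zero part of the inverse in S is again an inverse. -/
theorem isUnit_invRing (hζ : IsPrimitiveRoot ζ n) {r : invRing ζ a}
    (hr : constantCoeff (r : PS k) ≠ 0) : IsUnit r := by
  have hu : IsUnit (r : PS k) := by
    rw [MvPowerSeries.isUnit_iff_constantCoeff]; exact isUnit_iff_ne_zero.2 hr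
  obtain ⟨g, hg⟩ := hu.exists_right_inv
  have h1 := filt_mul (hasWt_coe hζ r) 0 g
  rw [hg, HasWt.one.filt_eq] at h1
  exact IsUnit.of_mul_eq_one ⟨_, (mem_invRing_iff hζ).2 (hasWt_filt 0 g)⟩ (Subtype.ext h1.symm)

theorem mem_maximalIdeal_iff (hζ : IsPrimitiveRoot ζ n) {r : invRing ζ a} :
    r ∈ IsLocalRing.maximalIdeal (invRing ζ a) ↔ constantCoeff (r : PS k) = 0 := by
  rw [IsLocalRing.mem_maximalIdeal, mem_nonunits_iff]
  constructor
  · intro h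
    by_contra h1
    exact h (isUnit_invRing hζ h1)
  · intro h hu
    have := (hu.map (invRing ζ a).val).map (constantCoeff (σ := Fin 2) (R := k))
    exact this.ne_zero h

/-- The invariant monomial `x ^ n` (for `i = 0`) or `y ^ n` (for `i = 1`). -/
def powX (hζ : IsPrimitiveRoot ζ n) (a : ℕ) (i : Fin 2) : invRing ζ a :=
  ⟨X i ^ n, (mem_invRing_iff hζ).2 (by
    fin_cases i
    · exact (HasWt.X0_pow n).congr (by simp [Nat.ModEq])
    · exact (HasWt.X1_pow n).congr (by simp [Nat.ModEq]))⟩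

theorem coe_powX (hζ : IsPrimitiveRoot ζ n) (i : Fin 2) : (powX hζ a i : PS k) = X i ^ n := rfl

theorem powX_mem (hζ : IsPrimitiveRoot ζ n) (i : Fin 2) :
    powX hζ a i ∈ IsLocalRing.maximalIdeal (invRing ζ a) := by
  rw [mem_maximalIdeal_iff hζ, coe_powX, map_pow, constantCoeff_X, zero_pow (NeZero.ne n)]

theorem powX_mem_of_mem (hζ : IsPrimitiveRoot ζ n) :
    ∀ r ∈ [powX hζ a 0, powX hζ a 1], r ∈ IsLocalRing.maximalIdeal (invRing ζ a) := by
  intro r hr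
  rw [List.mem_pair] at hr
  rcases hr with rfl | rfl <;> exact powX_mem hζ _

/-- A high power of a non-unit is a combination of `x ^ n` and `y ^ n` over the invariant ring. -/
theorem exists_pow_eq_of_mem_maximalIdeal (hζ : IsPrimitiveRoot ζ n) {r : invRing ζ a}
    (hr : r ∈ IsLocalRing.maximalIdeal (invRing ζ a)) :
    ∃ r₁ r₂ : invRing ζ a, r ^ (2 * n) = r₁ * powX hζ a 0 + r₂ * powX hζ a 1 := by
  rw [mem_maximalIdeal_iff hζ] at hr
  obtain ⟨f₁, f₂, h, h₁, h₂⟩ := exists_eq_add_of_support (U := n) (V := n)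
    (hasWt_coe hζ (r ^ (2 * n))) (by
      intro m hm
      by_contra hc
      -- Both exponents are below n, so the degree of m is below 2n, whereas r ^ (2n) has order at
      -- least 2n.
      push Not at hc
      refine hm ?_
      rw [SubmonoidClass.coe_pow]
      refine coeff_eq_zero_of_constantCoeff_nilpotent (m := 1) (by rw [hr, pow_one]) ?_
      rw [Finsupp.degree_eq_sum, Fin.sum_univ_two]
      omega)
  refine ⟨⟨f₁, (mem_invRing_iff hζ).2 (h₁.of_X0_pow_mul (by simp [Nat.ModEq]))⟩,
    ⟨f₂, (mem_invRing_iff hζ).2 (h₂.of_X1_pow_mul (by simp [Nat.ModEq]))⟩, Subtype.ext ?_⟩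
  rw [h]
  change _ = f₁ * X 0 ^ n + f₂ * X 1 ^ n
  ring

/-- Sorting monomials by the residues (u, v) of their exponents modulo n splits f into n² pieces,
each an invariant multiple of x^u y^v. -/
theorem finite_PS (hζ : IsPrimitiveRoot ζ n) : Module.Finite (invRing ζ a) (PS k) := by
  classical
  refine ⟨⟨(Finset.range n ×ˢ Finset.range n).image fun q => (X 0 ^ q.1 * X 1 ^ q.2 : PS k), ?_⟩⟩
  rw [eq_top_iff]
  rintro f -
  have hf : f = ∑ q ∈ Finset.range n ×ˢ Finset.range n,
      filt (fun m => m 0 % n = q.1 ∧ m 1 % n = q.2) f := by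
    ext m
    rw [map_sum, Finset.sum_eq_single (m 0 % n, m 1 % n)]
    · simp [coeff_filt]
    · rintro ⟨u, v⟩ _ hne
      rw [coeff_filt, if_neg]
      rintro ⟨rfl, rfl⟩
      exact hne rfl
    · intro h
      exact absurd (Finset.mem_product.2 ⟨Finset.mem_range.2 (Nat.mod_lt _ (NeZero.pos n)),
        Finset.mem_range.2 (Nat.mod_lt _ (NeZero.pos n))⟩) h
  rw [hf]
  refine Submodule.sum_mem _ ?_
  rintro ⟨u, v⟩ huv
  obtain ⟨g, hg⟩ : X 0 ^ u ∣ filt (fun m => m 0 % n = u ∧ m 1 % n = v) f :=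
    X_pow_dvd_filt (fun m hm => hm.1 ▸ Nat.mod_le _ _) f
  obtain ⟨h, hh⟩ : X 1 ^ v ∣ g := by
    refine X_pow_dvd_of_dvd_X_pow_mul (j := 0) (v := u) (by decide) ?_
    rw [← hg]
    exact X_pow_dvd_filt (fun m hm => hm.2 ▸ Nat.mod_le _ _) f
  have hwt : HasWt n a 0 h := by
    intro m hm
    have h1 : coeff (Finsupp.single 0 u + (Finsupp.single 1 v + m))
        (filt (fun m => m 0 % n = u ∧ m 1 % n = v) f) ≠ 0 := by
      rw [hg, hh, X_pow_eq, X_pow_eq, coeff_add_monomial_mul, coeff_add_monomial_mul, one_mul,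
        one_mul]
      exact hm
    rw [coeff_filt] at h1
    have h2 : (u + m 0) % n = u ∧ (v + m 1) % n = v := by
      by_contra hc
      rw [if_neg (by simpa using hc)] at h1
      exact h1 rfl
    have h3 : m 0 ≡ 0 [MOD n] := by
      refine Nat.ModEq.add_left_cancel' u ?_
      rw [Nat.ModEq, h2.1, add_zero, ← h2.1, Nat.mod_mod]
    have h4 : m 1 ≡ 0 [MOD n] := by
      refine Nat.ModEq.add_left_cancel' v ?_
      rw [Nat.ModEq, h2.2, add_zero, ← h2.2, Nat.mod_mod]
    simpa using h3.add (h4.mul_left a)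
  have : filt (fun m => m 0 % n = u ∧ m 1 % n = v) f =
      (⟨h, (mem_invRing_iff hζ).2 hwt⟩ : invRing ζ a) • (X 0 ^ u * X 1 ^ v : PS k) := by
    rw [hg, hh]
    change _ = h * (X 0 ^ u * X 1 ^ v)
    ring
  rw [this]
  refine Submodule.smul_mem _ _ (Submodule.subset_span ?_)
  exact Finset.mem_coe.2 (Finset.mem_image.2 ⟨(u, v), huv, rfl⟩)

theorem finite_semiInv (hζ : IsPrimitiveRoot ζ n) (s : ℕ) :
    Module.Finite (invRing ζ a) (semiInv ζ a s) := by
  have := isNoetherianRing_invRing (a := a) hζ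
  have := finite_PS (a := a) hζ
  infer_instance

theorem X0_pow_mem (hζ : IsPrimitiveRoot ζ n) (s : ℕ) : (X 0 ^ s : PS k) ∈ semiInv ζ a s :=
  (mem_semiInv_iff hζ).2 (HasWt.X0_pow s)

theorem nontrivial_semiInv (hζ : IsPrimitiveRoot ζ n) (s : ℕ) : Nontrivial (semiInv ζ a s) :=
  ⟨⟨⟨X 0 ^ s, X0_pow_mem hζ s⟩, 0, fun h => X_pow_ne_zero (k := k) 0 s (congrArg Subtype.val h)⟩⟩

theorem isRegular_semiInv (hζ : IsPrimitiveRoot ζ n) (s : ℕ) :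
    RingTheory.Sequence.IsRegular (semiInv ζ a s) [powX hζ a 0, powX hζ a 1] := by
  have := finite_semiInv (a := a) hζ s
  have := nontrivial_semiInv (a := a) hζ s
  rw [IsLocalRing.isRegular_iff_isWeaklyRegular_of_subset_maximalIdeal, isWeaklyRegular_pair_iff]
  · refine ⟨fun f hf => ?_, fun f g hfg => ?_⟩
    · have h1 : (X 0 ^ n : PS k) * f = 0 := congrArg Subtype.val hf
      exact Subtype.ext ((mul_eq_zero.1 h1).resolve_left (X_pow_ne_zero 0 n))
    · have h1 : (X 1 ^ n : PS k) * (f : PS k) = X 0 ^ n * (g : PS k) := congrArg Subtype.val hfg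
      obtain ⟨h, hh⟩ : X 0 ^ n ∣ (f : PS k) :=
        X_pow_dvd_of_dvd_X_pow_mul (j := 1) (v := n) (by decide) ⟨_, h1⟩
      have hf := (mem_semiInv_iff hζ).1 f.2
      rw [hh] at hf
      exact ⟨⟨h, (mem_semiInv_iff hζ).2 (hf.of_X0_pow_mul (by simp [Nat.ModEq]))⟩, Subtype.ext hh⟩
  · exact powX_mem_of_mem hζ

/-- The invariant ring is the module of semi-invariants of weight zero. -/
def equivSemiInvZero (ζ : k) (a : ℕ) : invRing ζ a ≃ₗ[invRing ζ a] semiInv ζ a 0 where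
  toFun r := ⟨r, show sigma ζ a r = ζ ^ 0 • (r : PS k) by rw [pow_zero, one_smul]; exact r.2⟩
  invFun f := ⟨f, show sigma ζ a f = f by
    have : sigma ζ a f = ζ ^ 0 • (f : PS k) := f.2
    rwa [pow_zero, one_smul] at this⟩
  map_add' _ _ := rfl
  map_smul' _ _ := rfl
  left_inv _ := rfl
  right_inv _ := rfl

/-- x^n, y^n is a regular sequence on R, and modulo it every non-unit is nilpotent, so the quotient
has dimension 0. -/
theorem ringKrullDim_invRing (hζ : IsPrimitiveRoot ζ n) : ringKrullDim (invRing ζ a) = (2 : ℕ) := by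
  have := isNoetherianRing_invRing (a := a) hζ
  have hreg := ((equivSemiInvZero ζ a).isRegular_congr _).2 (isRegular_semiInv (a := a) hζ 0)
  rw [← ringKrullDim_add_length_eq_ringKrullDim_of_isRegular _ hreg]
  set J := Ideal.ofList [powX hζ a 0, powX hζ a 1] with hJ
  have hle : J ≤ IsLocalRing.maximalIdeal (invRing ζ a) := by
    rw [hJ, Ideal.ofList, Ideal.span_le]
    exact powX_mem_of_mem hζ
  have hJtop : J ≠ ⊤ := fun h => (IsLocalRing.maximalIdeal.isMaximal _).ne_top (top_le_iff.1 (h ▸ hle))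
  have : Nontrivial (invRing ζ a ⧸ J) := Ideal.Quotient.nontrivial_iff.2 hJtop
  have hx : ∀ i, powX hζ a i ∈ J := by
    intro i
    refine Ideal.subset_span ?_
    fin_cases i <;> simp
  have key : Ring.KrullDimLE 0 (invRing ζ a ⧸ J) := by
    refine (((Ring.krullDimLE_zero_and_isLocalRing_tfae (invRing ζ a ⧸ J)).out 0 2 rfl rfl).mpr ?_).1
    intro x
    refine ⟨fun h hu => ?_, fun h => ?_⟩
    · obtain ⟨e, he⟩ := h
      have := hu.pow e
      rw [he] at this
      exact not_isUnit_zero this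
    · obtain ⟨r, rfl⟩ := Ideal.Quotient.mk_surjective x
      have hr : r ∈ IsLocalRing.maximalIdeal (invRing ζ a) := by
        rw [IsLocalRing.mem_maximalIdeal, mem_nonunits_iff]
        exact fun hu => h (hu.map _)
      obtain ⟨r₁, r₂, h2⟩ := exists_pow_eq_of_mem_maximalIdeal hζ hr
      refine ⟨2 * n, ?_⟩
      rw [← map_pow, Ideal.Quotient.eq_zero_iff_mem, h2]
      exact J.add_mem (J.mul_mem_left _ (hx 0)) (J.mul_mem_left _ (hx 1))
  rw [ringKrullDimZero_iff_ringKrullDim_eq_zero.1 key]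
  simp

theorem isMCM_semiInv (hζ : IsPrimitiveRoot ζ n) (s : ℕ) : IsMCM (invRing ζ a) (semiInv ζ a s) :=
  ⟨finite_semiInv hζ s, [powX hζ a 0, powX hζ a 1], powX_mem_of_mem hζ, isRegular_semiInv hζ s, by
    rw [ringKrullDim_invRing hζ]; rfl⟩

theorem free_semiInv_zero (ζ : k) (a : ℕ) : Module.Free (invRing ζ a) (semiInv ζ a 0) :=
  Module.Free.of_equiv (equivSemiInvZero ζ a)

/-- For `f, g` of weight `s`, the invariant `f ^ (n - 1) g`. -/
def powMul (hζ : IsPrimitiveRoot ζ n) {s : ℕ} (f g : semiInv ζ a s) : invRing ζ a :=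
  ⟨(f : PS k) ^ (n - 1) * g, (mem_invRing_iff hζ).2 (by
    refine ((((mem_semiInv_iff hζ).1 f.2).pow (n - 1)).mul ((mem_semiInv_iff hζ).1 g.2)).congr ?_
    obtain ⟨l, hl⟩ := Nat.exists_eq_add_of_le' (NeZero.one_le (n := n))
    rw [hl]
    simp only [Nat.add_sub_cancel]
    rw [show l * s + s = (l + 1) * s by ring]
    simp [Nat.ModEq])⟩

theorem powMul_smul_comm (hζ : IsPrimitiveRoot ζ n) {s : ℕ} (f g : semiInv ζ a s) :
    powMul hζ f g • f = powMul hζ f f • g := by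
  refine Subtype.ext ?_
  change ((f : PS k) ^ (n - 1) * g) * f = ((f : PS k) ^ (n - 1) * f) * g
  ring

theorem powMul_ne_zero (hζ : IsPrimitiveRoot ζ n) {s : ℕ} {f g : semiInv ζ a s} (hf : f ≠ 0)
    (hg : g ≠ 0) : powMul hζ f g ≠ 0 := by
  intro h
  have h1 : (f : PS k) ^ (n - 1) * g = 0 := congrArg Subtype.val h
  rcases mul_eq_zero.1 h1 with h2 | h2
  · exact hf (Subtype.ext (eq_zero_of_pow_eq_zero h2))
  · exact hg (Subtype.ext h2)

theorem smul_semiInv_eq_zero {s : ℕ} {r : invRing ζ a} {f : semiInv ζ a s} (h : r • f = 0) :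
    r = 0 ∨ f = 0 := by
  have h1 : (r : PS k) * f = 0 := congrArg Subtype.val h
  exact (mul_eq_zero.1 h1).imp (fun h => Subtype.ext h) (fun h => Subtype.ext h)

/-- M_s is torsion-free of rank one: by `powMul_smul_comm` two nonzero elements have a common
nonzero multiple, so nonzero submodules always meet. -/
theorem isIndecomposable_semiInv (hζ : IsPrimitiveRoot ζ n) (s : ℕ) :
    IsIndecomposable (invRing ζ a) (semiInv ζ a s) := by
  refine ⟨nontrivial_semiInv hζ s, fun A B hAB => ?_⟩
  by_contra! hc
  obtain ⟨f, hfA, hf⟩ := A.exists_mem_ne_zero_of_ne_bot hc.1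
  obtain ⟨g, hgB, hg⟩ := B.exists_mem_ne_zero_of_ne_bot hc.2
  have h1 : powMul hζ f g • f ∈ A ⊓ B :=
    ⟨A.smul_mem _ hfA, by rw [powMul_smul_comm]; exact B.smul_mem _ hgB⟩
  rw [hAB.inf_eq_bot, Submodule.mem_bot] at h1
  rcases smul_semiInv_eq_zero h1 with h2 | h2
  · exact powMul_ne_zero hζ hf hg h2
  · exact hf h2

/-- Rank one makes a basis a singleton. Its element divides both x^s and y^j, so it is a unit of S;
a nonzero constant term forces weight 0. -/
theorem not_free_semiInv (hζ : IsPrimitiveRoot ζ n) {s j : ℕ} (hs : ¬ s ≡ 0 [MOD n])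
    (hj : a * j ≡ s [MOD n]) : ¬ Module.Free (invRing ζ a) (semiInv ζ a s) := by
  intro hfree
  have := nontrivial_semiInv (a := a) hζ s
  let b := Module.Free.chooseBasis (invRing ζ a) (semiInv ζ a s)
  have hsub : Subsingleton (Module.Free.ChooseBasisIndex (invRing ζ a) (semiInv ζ a s)) := by
    refine ⟨fun i j => ?_⟩
    by_contra hij
    have h := congrArg (fun z => b.repr z i) (powMul_smul_comm hζ (b i) (b j))
    simp only [map_smul, Module.Basis.repr_self, Finsupp.smul_apply, Finsupp.single_eq_same,
      Finsupp.single_eq_of_ne hij, smul_zero] at h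
    rw [smul_eq_mul, mul_one] at h
    exact powMul_ne_zero hζ (b.ne_zero i) (b.ne_zero j) h
  obtain ⟨i⟩ : Nonempty (Module.Free.ChooseBasisIndex (invRing ζ a) (semiInv ζ a s)) :=
    b.index_nonempty
  have hgen : ∀ f : semiInv ζ a s, (f : PS k) = (b.repr f i : PS k) * b i := by
    intro f
    have h : f = b.repr f i • b i := by
      refine b.ext_elem fun l => ?_
      rw [Subsingleton.elim l i]
      simp
    exact congrArg Subtype.val h
  have h1 := hgen ⟨X 0 ^ s, X0_pow_mem hζ s⟩
  have h2 := hgen ⟨X 1 ^ j, (mem_semiInv_iff hζ).2 ((HasWt.X1_pow j).congr hj)⟩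
  simp only at h1 h2
  set r₁ : PS k := (b.repr ⟨X 0 ^ s, X0_pow_mem hζ s⟩ i : PS k)
  set r₂ : PS k := (b.repr ⟨X 1 ^ j, (mem_semiInv_iff hζ).2 ((HasWt.X1_pow j).congr hj)⟩ i : PS k)
  have hb : ((b i : semiInv ζ a s) : PS k) ≠ 0 := fun h => b.ne_zero i (Subtype.ext h)
  have h3 : X 1 ^ j * r₁ = X 0 ^ s * r₂ := by
    refine mul_right_cancel₀ hb ?_
    rw [mul_assoc, mul_assoc, ← h1, ← h2, mul_comm]
  obtain ⟨r₃, h4⟩ := X_pow_dvd_of_dvd_X_pow_mul (by decide) (Dvd.intro _ h3.symm)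
  have h5 : r₃ * b i = 1 := by
    refine mul_left_cancel₀ (X_pow_ne_zero 0 s) ?_
    rw [mul_one, ← mul_assoc, ← h4, ← h1]
  have h6 : constantCoeff (b i : PS k) ≠ 0 := by
    intro h
    have := congrArg constantCoeff h5
    rw [map_mul, h, mul_zero, map_one] at this
    exact zero_ne_one this
  have h7 := (mem_semiInv_iff hζ).1 (b i).2 0 h6
  exact hs (by simpa using h7.symm)

end Ring

/-- If every element of `N` is multiplied into `L ≤ N` by powers of `r₁` and of `r₂`, and `r₁, r₂` is
a regular sequence on `L`, then `L = N`. -/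
theorem le_of_weaklyRegular_pair {R M : Type*} [CommRing R] [AddCommGroup M] [Module R M]
    {L N : Submodule R M} {r₁ r₂ : R} (h₁ : ∀ f ∈ N, ∃ e : ℕ, r₁ ^ e • f ∈ L)
    (h₂ : ∀ f ∈ N, ∃ e : ℕ, r₂ ^ e • f ∈ L) (hinj : ∀ f : M, r₁ • f = 0 → f = 0)
    (hreg : ∀ f g : L, r₂ • f = r₁ • g → ∃ h : L, f = r₁ • h) : N ≤ L := by
  classical
  have step : ∀ r : R, (∀ f ∈ N, ∃ e : ℕ, r ^ e • f ∈ L) → ∀ f ∈ N, f ∉ L →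
      ∃ e : ℕ, r ^ e • f ∉ L ∧ r • r ^ e • f ∈ L := by
    intro r hr f hf hfL
    have hne : Nat.find (hr f hf) ≠ 0 := by
      intro h0
      have := Nat.find_spec (hr f hf)
      rw [h0, pow_zero, one_smul] at this
      exact hfL this
    obtain ⟨e, he⟩ := Nat.exists_eq_succ_of_ne_zero hne
    refine ⟨e, Nat.find_min (hr f hf) (by omega), ?_⟩
    have := Nat.find_spec (hr f hf)
    rwa [he, Nat.succ_eq_add_one, pow_succ', mul_smul] at this
  intro f₀ hf₀
  by_contra hf₀L
  -- Two minimal choices of exponent produce an element outside L which both r₁ and r₂ multiply into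
  -- L; regularity on L then puts it into L.
  obtain ⟨e₁, h1, h1'⟩ := step r₁ h₁ f₀ hf₀ hf₀L
  obtain ⟨e₂, h2, h2'⟩ := step r₂ h₂ _ (N.smul_mem _ hf₀) h1
  set f := r₂ ^ e₂ • r₁ ^ e₁ • f₀
  have h3 : r₁ • f ∈ L := by rw [smul_comm]; exact L.smul_mem _ h1'
  obtain ⟨h, hh⟩ := hreg ⟨r₁ • f, h3⟩ ⟨r₂ • f, h2'⟩ (Subtype.ext (smul_comm _ _ _))
  have h4 : r₁ • (f - h) = 0 := by rw [smul_sub, sub_eq_zero]; exact congrArg Subtype.val hh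
  have h5 := sub_eq_zero.1 (hinj _ h4)
  exact h2 (h5 ▸ h.2)

/-- Special modules in terms of a map whose kernel is the torsion of the tensor product. -/
theorem isSpecial_iff_of_torsion_eq_ker {R M W P : Type*} [CommRing R] [IsLocalRing R]
    [AddCommGroup M] [Module R M] [AddCommGroup W] [Module R W] [AddCommGroup P] [Module R P]
    {μ : M ⊗[R] W →ₗ[R] P} (h : Submodule.torsion R (M ⊗[R] W) = LinearMap.ker μ) :
    IsSpecial R W M ↔ IsMCM R M ∧ IsMCM R (LinearMap.range μ) := by
  let e := (Submodule.quotEquivOfEq _ _ h).trans μ.quotKerEquivRange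
  exact and_congr_right fun _ => ⟨fun hM => hM.congr e, fun hM => hM.congr e.symm⟩

/-! ### Special modules: when the product M_s ω is all of its weight space -/

section Special
variable {k : Type*} [Field k] {n a : ℕ} {ζ : k}

/-- The multiplication map `M_s ⊗ M_t → S`. -/
def mulMap (ζ : k) (a s t : ℕ) :
    (semiInv ζ a s) ⊗[invRing ζ a] (semiInv ζ a t) →ₗ[invRing ζ a] PS k :=
  TensorProduct.lift ((LinearMap.mul (invRing ζ a) (PS k)).compl₁₂ (semiInv ζ a s).subtype
    (semiInv ζ a t).subtype)

theorem mulMap_tmul {s t : ℕ} (f : semiInv ζ a s) (g : semiInv ζ a t) :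
    mulMap ζ a s t (f ⊗ₜ g) = (f : PS k) * g := rfl

theorem mul_mem_range {s t : ℕ} {f g : PS k} (hf : f ∈ semiInv ζ a s) (hg : g ∈ semiInv ζ a t) :
    f * g ∈ LinearMap.range (mulMap ζ a s t) := ⟨⟨f, hf⟩ ⊗ₜ ⟨g, hg⟩, rfl⟩

variable [NeZero n]

/-- The tensor product has rank one: for nonzero f₀, g₀, a nonzero multiple of z is a multiple of f₀
⊗ g₀, and the multiplier is read off from the image of z in S. Hence a tensor with image 0 is
torsion. -/
theorem exists_smul_eq_smul_tmul (hζ : IsPrimitiveRoot ζ n) {s t : ℕ} (f₀ : semiInv ζ a s)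
    (g₀ : semiInv ζ a t) (z : (semiInv ζ a s) ⊗[invRing ζ a] (semiInv ζ a t)) :
    ∃ r : invRing ζ a, (r : PS k) = (f₀ : PS k) ^ (n - 1) * (g₀ : PS k) ^ (n - 1) * mulMap ζ a s t z ∧
      (powMul hζ f₀ f₀ * powMul hζ g₀ g₀) • z = r • (f₀ ⊗ₜ[invRing ζ a] g₀) := by
  induction z using TensorProduct.induction_on with
  | zero => exact ⟨0, by simp, by simp⟩
  | tmul f g =>
    refine ⟨powMul hζ f₀ f * powMul hζ g₀ g, ?_, ?_⟩
    · rw [mulMap_tmul]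
      change ((f₀ : PS k) ^ (n - 1) * f) * ((g₀ : PS k) ^ (n - 1) * g) = _
      ring
    · rw [← TensorProduct.smul_tmul_smul, ← powMul_smul_comm, ← powMul_smul_comm,
        TensorProduct.smul_tmul_smul]
  | add z w hz hw =>
    obtain ⟨r, h1, h2⟩ := hz
    obtain ⟨r', h1', h2'⟩ := hw
    refine ⟨r + r', ?_, ?_⟩
    · rw [map_add, mul_add, ← h1, ← h1']; rfl
    · rw [smul_add, h2, h2', add_smul]

theorem torsion_eq_ker_mulMap (hζ : IsPrimitiveRoot ζ n) (s t : ℕ) :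
    Submodule.torsion (invRing ζ a) ((semiInv ζ a s) ⊗[invRing ζ a] (semiInv ζ a t)) =
      LinearMap.ker (mulMap ζ a s t) := by
  ext z
  rw [Submodule.mem_torsion_iff, LinearMap.mem_ker]
  constructor
  · rintro ⟨r, hr⟩
    have h1 : ((r : invRing ζ a) : PS k) * mulMap ζ a s t z = 0 := by
      have := congrArg (mulMap ζ a s t) hr
      rw [map_zero] at this
      rw [← this]
      exact (map_smul (mulMap ζ a s t) (r : invRing ζ a) z).symm
    refine (mul_eq_zero.1 h1).resolve_left fun h => ?_
    exact nonZeroDivisors.ne_zero r.2 (Subtype.ext h)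
  · intro hz
    have hf : (⟨X 0 ^ s, X0_pow_mem hζ s⟩ : semiInv ζ a s) ≠ 0 := fun h =>
      X_pow_ne_zero (k := k) 0 s (congrArg Subtype.val h)
    have hg : (⟨X 0 ^ t, X0_pow_mem hζ t⟩ : semiInv ζ a t) ≠ 0 := fun h =>
      X_pow_ne_zero (k := k) 0 t (congrArg Subtype.val h)
    obtain ⟨r, h1, h2⟩ := exists_smul_eq_smul_tmul hζ ⟨X 0 ^ s, X0_pow_mem hζ s⟩
      (⟨X 0 ^ t, X0_pow_mem hζ t⟩ : semiInv ζ a t) z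
    rw [hz, mul_zero] at h1
    have hr : r = 0 := Subtype.ext h1
    rw [hr, zero_smul] at h2
    exact ⟨⟨_, mem_nonZeroDivisors_of_ne_zero
      (mul_ne_zero (powMul_ne_zero hζ hf hf) (powMul_ne_zero hζ hg hg))⟩, h2⟩

theorem isSpecial_semiInv_iff (hζ : IsPrimitiveRoot ζ n) (s : ℕ) :
    IsSpecial (invRing ζ a) (canonicalModule ζ a) (semiInv ζ a s) ↔
      IsMCM (invRing ζ a) (LinearMap.range (mulMap ζ a s ((1 + a) * (n - 1)))) := by
  rw [canonicalModule_eq hζ, isSpecial_iff_of_torsion_eq_ker (torsion_eq_ker_mulMap (a := a) hζ s _)]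
  exact and_iff_right (isMCM_semiInv hζ s)

theorem range_mulMap_le (hζ : IsPrimitiveRoot ζ n) (s t : ℕ) :
    LinearMap.range (mulMap ζ a s t) ≤ semiInv ζ a (s + t) := by
  rintro _ ⟨z, rfl⟩
  induction z using TensorProduct.induction_on with
  | zero => rw [map_zero]; exact Submodule.zero_mem _
  | tmul f g =>
    rw [mulMap_tmul]
    exact (mem_semiInv_iff hζ).2 (((mem_semiInv_iff hζ).1 f.2).mul ((mem_semiInv_iff hζ).1 g.2))
  | add z w hz hw => rw [map_add]; exact Submodule.add_mem _ hz hw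

theorem X1_pow_mem (hζ : IsPrimitiveRoot ζ n) {s j : ℕ} (hj : a * j ≡ s [MOD n]) :
    (X 1 ^ j : PS k) ∈ semiInv ζ a s := (mem_semiInv_iff hζ).2 ((HasWt.X1_pow j).congr hj)

/-- A monomial of weight s + t divisible by x^s or y^j has a cofactor of weight t, so products with
these two elements of M_s already suffice. -/
theorem range_mulMap_eq (hζ : IsPrimitiveRoot ζ n) {s t j : ℕ} (hj : a * j ≡ s [MOD n])
    (h : ∀ u v, u + a * v ≡ s + t [MOD n] → s ≤ u ∨ j ≤ v) :
    LinearMap.range (mulMap ζ a s t) = semiInv ζ a (s + t) := by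
  refine le_antisymm (range_mulMap_le hζ s t) fun f hf => ?_
  have hf' := (mem_semiInv_iff hζ).1 hf
  obtain ⟨f₁, f₂, rfl, h₁, h₂⟩ := exists_eq_add_of_support (U := s) (V := j) hf'
    fun m hm => h _ _ (hf' m hm)
  refine Submodule.add_mem _ (mul_mem_range (X0_pow_mem hζ s) ?_) (mul_mem_range (X1_pow_mem hζ hj) ?_)
  · exact (mem_semiInv_iff hζ).2 (h₁.of_X0_pow_mul rfl)
  · exact (mem_semiInv_iff hζ).2 (h₂.of_X1_pow_mul (hj.add_right t))

theorem semiInv_eq_span (hζ : IsPrimitiveRoot ζ n) {s j : ℕ} (hj : a * j ≡ s [MOD n])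
    (h : ∀ u v, u + a * v ≡ s [MOD n] → s ≤ u ∨ j ≤ v) :
    semiInv ζ a s = Submodule.span (invRing ζ a) {(X 0 ^ s : PS k), (X 1 ^ j : PS k)} := by
  refine le_antisymm (fun f hf => ?_) (Submodule.span_le.2 ?_)
  · have hf' := (mem_semiInv_iff hζ).1 hf
    obtain ⟨f₁, f₂, rfl, h₁, h₂⟩ := exists_eq_add_of_support (U := s) (V := j) hf'
      fun m hm => h _ _ (hf' m hm)
    rw [Submodule.mem_span_pair]
    refine ⟨⟨f₁, (mem_invRing_iff hζ).2 (h₁.of_X0_pow_mul rfl)⟩,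
      ⟨f₂, (mem_invRing_iff hζ).2 (h₂.of_X1_pow_mul hj)⟩, ?_⟩
    change f₁ * X 0 ^ s + f₂ * X 1 ^ j = _
    ring
  · rintro f (rfl | rfl)
    · exact X0_pow_mem hζ s
    · exact X1_pow_mem hζ hj

/-- With z the chosen variable, z^{nj} f = z^j · (z^{j(n-1)} f), and the second factor has weight
(n-1)s + s + t ≡ t. -/
theorem powX_pow_smul_mem_range (hζ : IsPrimitiveRoot ζ n) {s t j : ℕ} {i : Fin 2}
    (hj : (X i ^ j : PS k) ∈ semiInv ζ a s) {f : PS k} (hf : f ∈ semiInv ζ a (s + t)) :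
    powX hζ a i ^ j • f ∈ LinearMap.range (mulMap ζ a s t) := by
  have h1 : powX hζ a i ^ j • f = X i ^ j * ((X i ^ j) ^ (n - 1) * f) := by
    change (X i ^ n) ^ j * f = _
    rw [← mul_assoc, ← pow_succ', Nat.sub_add_cancel (NeZero.one_le (n := n)), ← pow_mul, ← pow_mul,
      mul_comm n]
  rw [h1]
  refine mul_mem_range hj ((mem_semiInv_iff hζ).2 ?_)
  refine ((((mem_semiInv_iff hζ).1 hj).pow (n - 1)).mul ((mem_semiInv_iff hζ).1 hf)).congr ?_
  obtain ⟨l, hl⟩ := Nat.exists_eq_add_of_le' (NeZero.one_le (n := n))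
  rw [hl]
  simp only [Nat.add_sub_cancel]
  rw [show l * s + (s + t) = (l + 1) * s + t by ring]
  simp [Nat.ModEq]

/-- Every element of the maximal ideal has a power multiplying M_{s+t} into the product, since this
holds for x^n and y^n. A module of depth two has no proper torsion-free extension of this kind, by
`le_of_weaklyRegular_pair`. -/
theorem semiInv_le_range_of_isMCM (hζ : IsPrimitiveRoot ζ n) {s t j : ℕ} (hj : a * j ≡ s [MOD n])
    (h : IsMCM (invRing ζ a) (LinearMap.range (mulMap ζ a s t))) :
    semiInv ζ a (s + t) ≤ LinearMap.range (mulMap ζ a s t) := by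
  obtain ⟨-, rs, hrs, hreg, hlen⟩ := h
  rw [ringKrullDim_invRing hζ] at hlen
  obtain ⟨r₁, r₂, rfl⟩ := List.length_eq_two.1 (by exact_mod_cast hlen.symm)
  obtain ⟨h1, h2⟩ := (isWeaklyRegular_pair_iff r₁ r₂).1 hreg.toIsWeaklyRegular
  set L := LinearMap.range (mulMap ζ a s t)
  let I : Ideal (invRing ζ a) := L.colon (semiInv ζ a (s + t) : Set (PS k))
  have hI : IsLocalRing.maximalIdeal (invRing ζ a) ≤ I.radical := by
    intro r hr
    obtain ⟨c, d, hcd⟩ := exists_pow_eq_of_mem_maximalIdeal hζ hr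
    have hX : ∀ i e, (X i ^ e : PS k) ∈ semiInv ζ a s → powX hζ a i ∈ I.radical := fun i e hi =>
      ⟨e, Submodule.mem_colon.2 fun f hf => powX_pow_smul_mem_range hζ hi hf⟩
    rw [← Ideal.radical_idem]
    refine ⟨2 * n, ?_⟩
    rw [hcd]
    exact Ideal.add_mem _ (Ideal.mul_mem_left _ _ (hX 0 s (X0_pow_mem hζ s)))
      (Ideal.mul_mem_left _ _ (hX 1 j (X1_pow_mem hζ hj)))
  have hpow : ∀ r ∈ [r₁, r₂], ∀ f ∈ semiInv ζ a (s + t), ∃ e : ℕ, r ^ e • f ∈ L := by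
    intro r hr f hf
    obtain ⟨e, he⟩ := hI (hrs r hr)
    exact ⟨e, Submodule.mem_colon.1 he f hf⟩
  refine le_of_weaklyRegular_pair (hpow r₁ (by simp)) (hpow r₂ (by simp)) (fun f hf => ?_) h2
  have h3 : (r₁ : PS k) * f = 0 := hf
  refine (mul_eq_zero.1 h3).resolve_left fun h0 => ?_
  have h4 := h1 ⟨_, mul_mem_range (X0_pow_mem hζ s) (X0_pow_mem hζ t)⟩
    (Subtype.ext (show (r₁ : PS k) * _ = 0 by rw [h0, zero_mul]))
  have h5 : (X 0 ^ s * X 0 ^ t : PS k) = 0 := congrArg Subtype.val h4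
  exact mul_ne_zero (X_pow_ne_zero 0 s) (X_pow_ne_zero 0 t) h5

theorem exists_add_eq_of_mem_range (hζ : IsPrimitiveRoot ζ n) {s t : ℕ} {f : PS k}
    (hf : f ∈ LinearMap.range (mulMap ζ a s t)) (m : Fin 2 →₀ ℕ) (hm : coeff m f ≠ 0) :
    ∃ m₁ m₂ : Fin 2 →₀ ℕ, m₁ + m₂ = m ∧ m₁ 0 + a * m₁ 1 ≡ s [MOD n] ∧
      m₂ 0 + a * m₂ 1 ≡ t [MOD n] := by
  classical
  obtain ⟨z, rfl⟩ := hf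
  induction z using TensorProduct.induction_on with
  | zero => simp at hm
  | tmul f g =>
    rw [mulMap_tmul, MvPowerSeries.coeff_mul] at hm
    obtain ⟨⟨u, v⟩, huv, h⟩ := Finset.exists_ne_zero_of_sum_ne_zero hm
    rw [Finset.HasAntidiagonal.mem_antidiagonal] at huv
    exact ⟨u, v, huv, (mem_semiInv_iff hζ).1 f.2 u (left_ne_zero_of_mul h),
      (mem_semiInv_iff hζ).1 g.2 v (right_ne_zero_of_mul h)⟩
  | add z w hz hw =>
    by_cases h : coeff m (mulMap ζ a s t z) = 0
    · exact hw (by simpa [h] using hm)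
    · exact hz h

/-- For a special module `M_s`, each monomial of weight `s` divisible by `x y` is divisible by another
monomial of weight `s`, with a quotient divisible by `x y`. -/
theorem exists_monomial_of_isSpecial (hζ : IsPrimitiveRoot ζ n) {s j : ℕ} (hj : a * j ≡ s [MOD n])
    (h : IsSpecial (invRing ζ a) (canonicalModule ζ a) (semiInv ζ a s)) {u v : ℕ}
    (huv : (u + 1) + a * (v + 1) ≡ s [MOD n]) :
    ∃ u₁ v₁, u₁ ≤ u ∧ v₁ ≤ v ∧ u₁ + a * v₁ ≡ s [MOD n] := by
  have h1 := semiInv_le_range_of_isMCM hζ hj ((isSpecial_semiInv_iff hζ s).1 h)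
  have h2 : (X 0 ^ u * X 1 ^ v : PS k) ∈ semiInv ζ a (s + (1 + a) * (n - 1)) := by
    refine (mem_semiInv_iff hζ).2 ((HasWt.monomial u v).congr ?_)
    refine Nat.ModEq.trans ?_ (huv.add_right ((1 + a) * (n - 1)))
    obtain ⟨l, hl⟩ := Nat.exists_eq_add_of_le' (NeZero.one_le (n := n))
    rw [hl]
    simp only [Nat.add_sub_cancel]
    rw [show u + 1 + a * (v + 1) + (1 + a) * l = u + a * v + (l + 1) * (1 + a) by ring]
    simp [Nat.ModEq]
  obtain ⟨m₁, m₂, h3, h4, -⟩ := exists_add_eq_of_mem_range hζ (h1 h2)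
    (Finsupp.single 0 u + Finsupp.single 1 v)
    (by rw [X_pow_eq, X_pow_eq, monomial_mul_monomial, coeff_monomial_same]; simp)
  refine ⟨m₁ 0, m₁ 1, ?_, ?_, h4⟩
  · have := DFunLike.congr_fun h3 0
    simp at this
    omega
  · have := DFunLike.congr_fun h3 1
    simp at this
    omega

/-- A shift of the exponents by (1, 1) turns the hypothesis into that of `range_mulMap_eq` for the
weight -(1 + a). -/
theorem isSpecial_of_support (hζ : IsPrimitiveRoot ζ n) {s j : ℕ} (hj : a * j ≡ s [MOD n])
    (h : ∀ u v, (u + 1) + a * (v + 1) ≡ s [MOD n] → s ≤ u ∨ j ≤ v) :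
    IsSpecial (invRing ζ a) (canonicalModule ζ a) (semiInv ζ a s) := by
  rw [isSpecial_semiInv_iff hζ, range_mulMap_eq hζ hj]
  · exact isMCM_semiInv hζ _
  · intro u v huv
    refine h u v ?_
    have := huv.add_right (1 + a)
    rw [show u + a * v + (1 + a) = u + 1 + a * (v + 1) by ring] at this
    refine this.trans ?_
    obtain ⟨l, hl⟩ := Nat.exists_eq_add_of_le' (NeZero.one_le (n := n))
    rw [hl]
    simp only [Nat.add_sub_cancel]
    rw [show s + (1 + a) * l + (1 + a) = s + (l + 1) * (1 + a) by ring]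
    simp [Nat.ModEq]

end Special

/-! ### Lattice geometry of the i-series and the j-series -/

section ContinuedFraction
variable {n a : ℕ} {α : List ℕ}

theorem one_lt_hjEval : ∀ {l : List ℕ}, l ≠ [] → (∀ c ∈ l, 2 ≤ c) → 1 < hjEval l
  | [], h, _ => absurd rfl h
  | [c], _, h => by
    have : 2 ≤ c := h c (by simp)
    simp only [hjEval]
    exact_mod_cast this
  | c :: d :: l, _, h => by
    have h1 : (2 : ℚ) ≤ c := by exact_mod_cast h c (by simp)
    have h2 := one_lt_hjEval (l := d :: l) (by simp) fun e he => h e (by simp_all)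
    simp only [hjEval]
    have h3 : 1 / hjEval (d :: l) < 1 := by
      rw [div_lt_one (by linarith)]; exact h2
    linarith

/-- The recursion changes consecutive pairs by a matrix of determinant one, so the initial value n
persists. Consecutive points thus form a basis of the index-n lattice u ≡ a w. -/
theorem det_series (n a : ℕ) (α : List ℕ) (t : ℕ) :
    iSeries n a α t * jSeries α (t + 1) - iSeries n a α (t + 1) * jSeries α t = n := by
  induction t with
  | zero => simp [iSeries, jSeries]
  | succ t ih =>
    simp only [iSeries, jSeries]
    linear_combination ih

theorem dvd_iSeries_sub (n a : ℕ) (α : List ℕ) :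
    ∀ t : ℕ, (n : ℤ) ∣ iSeries n a α t - a * jSeries α t
  | 0 => by simp [iSeries, jSeries]
  | 1 => by simp [iSeries, jSeries]
  | t + 2 => by
    have h1 := dvd_iSeries_sub n a α t
    have h2 := dvd_iSeries_sub n a α (t + 1)
    simp only [iSeries, jSeries]
    obtain ⟨c, hc⟩ := h1
    obtain ⟨e, he⟩ := h2
    exact ⟨α.getD t 0 * e - c, by linear_combination (α.getD t 0 : ℤ) * he - hc⟩

/-- Dividing the recursion by i_{t+1} reproduces the step c - 1/tail of the continued fraction.
Tails exceed 1, so the next term stays positive. -/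
theorem iSeries_div (hα : IsHJExpansion n a α) (hn : 0 < n) (ha : 0 < a) (t : ℕ) (ht : t < α.length) :
    0 < iSeries n a α t ∧ 0 < iSeries n a α (t + 1) ∧
      (iSeries n a α t : ℚ) / iSeries n a α (t + 1) = hjEval (α.drop t) := by
  induction t with
  | zero => exact ⟨by simpa [iSeries] using hn, by simpa [iSeries] using ha, by
      simpa [iSeries] using hα.2⟩
  | succ t ih =>
    obtain ⟨h0, h1, h2⟩ := ih (by omega)
    obtain ⟨c, l, hcl⟩ : ∃ c l, α.drop (t + 1) = c :: l := by
      cases h : α.drop (t + 1) with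
      | nil => rw [List.drop_eq_nil_iff] at h; omega
      | cons c l => exact ⟨c, l, rfl⟩
    have hgt : 1 < hjEval (α.drop (t + 1)) := one_lt_hjEval (by rw [hcl]; simp)
      fun d hd => hα.1 d (List.mem_of_mem_drop hd)
    have hrec : hjEval (α.drop t) = (α.getD t 0 : ℚ) - 1 / hjEval (α.drop (t + 1)) := by
      rw [List.drop_eq_getElem_cons (by omega : t < α.length), hcl, hjEval,
        List.getD_eq_getElem _ _ (by omega : t < α.length)]
    have h1' : (0 : ℚ) < iSeries n a α (t + 1) := by exact_mod_cast h1
    have h3 : (iSeries n a α (t + 2) : ℚ) * hjEval (α.drop (t + 1)) = iSeries n a α (t + 1) := by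
      rw [hrec, div_eq_iff h1'.ne'] at h2
      have h4 : (iSeries n a α (t + 2) : ℚ) =
          (α.getD t 0 : ℚ) * iSeries n a α (t + 1) - iSeries n a α t := by
        simp only [iSeries]; push_cast; ring
      rw [h4, h2]
      have : hjEval (α.drop (t + 1)) ≠ 0 := by linarith
      field_simp
      ring
    have h5 : (0 : ℚ) < iSeries n a α (t + 2) := by
      by_contra hc
      push Not at hc
      nlinarith
    refine ⟨h1, by exact_mod_cast h5, ?_⟩
    rw [div_eq_iff h5.ne', ← h3, mul_comm]

theorem length_pos_of_isHJExpansion (hα : IsHJExpansion n a α) (hn : 0 < n) (ha : 0 < a) :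
    0 < α.length := by
  by_contra h
  have h0 : α = [] := List.length_eq_zero_iff.1 (by omega)
  have h1 := hα.2
  rw [h0] at h1
  have : (0 : ℚ) < n / a := by positivity
  rw [h1] at this
  exact lt_irrefl _ this

/-- The last tail is the single entry α_r, so i_{r-1} = α_r i_r. -/
theorem iSeries_length_succ (hα : IsHJExpansion n a α) (hn : 0 < n) (ha : 0 < a) :
    iSeries n a α (α.length + 1) = 0 := by
  obtain ⟨t, ht⟩ := Nat.exists_eq_succ_of_ne_zero (length_pos_of_isHJExpansion hα hn ha).ne'
  obtain ⟨-, h1, h2⟩ := iSeries_div hα hn ha t (by omega)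
  rw [List.drop_eq_getElem_cons (by omega : t < α.length), List.drop_eq_nil_of_le (by omega),
    hjEval, div_eq_iff (by exact_mod_cast h1.ne')] at h2
  rw [ht]
  simp only [iSeries]
  rw [List.getD_eq_getElem _ _ (by omega : t < α.length), sub_eq_zero]
  exact_mod_cast h2.symm

theorem iSeries_lt (hα : IsHJExpansion n a α) (hn : 0 < n) (ha : 0 < a) (t : ℕ)
    (ht : t ≤ α.length) : 0 ≤ iSeries n a α (t + 1) ∧ iSeries n a α (t + 1) < iSeries n a α t := by
  rcases ht.lt_or_eq with ht | rfl
  · obtain ⟨h0, h1, h2⟩ := iSeries_div hα hn ha t ht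
    refine ⟨h1.le, ?_⟩
    have hgt : 1 < hjEval (α.drop t) := one_lt_hjEval (by
      rw [ne_eq, List.drop_eq_nil_iff]; omega) fun d hd => hα.1 d (List.mem_of_mem_drop hd)
    rw [← h2, one_lt_div (by exact_mod_cast h1)] at hgt
    exact_mod_cast hgt
  · obtain ⟨t, ht⟩ := Nat.exists_eq_succ_of_ne_zero (length_pos_of_isHJExpansion hα hn ha).ne'
    obtain ⟨-, h1, -⟩ := iSeries_div hα hn ha t (by omega)
    rw [iSeries_length_succ hα hn ha, ht]
    exact ⟨le_rfl, h1⟩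

theorem jSeries_lt (hα : ∀ c ∈ α, 2 ≤ c) (t : ℕ) (ht : t ≤ α.length) :
    0 ≤ jSeries α t ∧ jSeries α t < jSeries α (t + 1) := by
  induction t with
  | zero => simp [jSeries]
  | succ t ih =>
    obtain ⟨h1, h2⟩ := ih (by omega)
    refine ⟨by omega, ?_⟩
    simp only [jSeries]
    have h3 : (2 : ℤ) ≤ α.getD t 0 := by
      rw [List.getD_eq_getElem _ _ (by omega : t < α.length)]
      exact_mod_cast hα _ (List.getElem_mem _)
    nlinarith

/-- A point `(u, w)` of the lattice `u ≡ a w` with `0 ≤ u < i_t` and `1 ≤ w` has `j_{t+1} ≤ w`. -/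
theorem jSeries_succ_le (hα : IsHJExpansion n a α) (hn : 0 < n) (ha : 0 < a) {t : ℕ}
    (ht : t ≤ α.length) {u w : ℤ} (hu : (n : ℤ) ∣ u - a * w) (h0 : 0 ≤ u)
    (h1 : u < iSeries n a α t) (hw : 1 ≤ w) : jSeries α (t + 1) ≤ w := by
  have hdet := det_series n a α t
  obtain ⟨hi0, hi⟩ := iSeries_lt hα hn ha t ht
  obtain ⟨hj0, hj⟩ := jSeries_lt hα.1 t ht
  obtain ⟨d, hd⟩ := dvd_iSeries_sub n a α t
  obtain ⟨e, he⟩ := dvd_iSeries_sub n a α (t + 1)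
  obtain ⟨c, hc⟩ := hu
  generalize iSeries n a α t = i at *
  generalize iSeries n a α (t + 1) = i' at *
  generalize jSeries α t = j at *
  generalize jSeries α (t + 1) = j' at *
  have hn' : (n : ℤ) ≠ 0 := by exact_mod_cast hn.ne'
  -- Cramer's rule: x and y are the coordinates of (u, w) in the basis (i, j), (i', j'), the
  -- division by n being carried out through c, d, e.
  obtain ⟨x, hx⟩ : ∃ x, x = c * j' - e * w := ⟨_, rfl⟩
  obtain ⟨y, hy⟩ : ∃ y, y = d * w - c * j := ⟨_, rfl⟩
  have hwe : w = x * j + y * j' := by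
    refine mul_left_cancel₀ hn' ?_
    rw [hx, hy]
    linear_combination (j' * w) * hd - w * j * he - w * hdet
  have hue : u = x * i + y * i' := by
    refine mul_left_cancel₀ hn' ?_
    rw [hx, hy]
    linear_combination (-u) * hdet + (i' * w) * hd - w * i * he + (i * j' - i' * j) * hc
  -- If y ≤ 0, then w ≥ 1 forces x + y ≥ 1, whence u ≥ (x + y) i ≥ i. Otherwise x ≤ 0 < x + y,
  -- whence w ≥ (x + y) j' ≥ j'.
  rcases le_or_gt y 0 with hy0 | hy0
  · exfalso
    have hxy : -y < x := by
      by_contra hcon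
      push Not at hcon
      nlinarith
    nlinarith
  · have hx0 : x ≤ 0 := by
      by_contra hcon
      push Not at hcon
      nlinarith
    have hxy : -x < y := by
      by_contra hcon
      push Not at hcon
      nlinarith
    nlinarith

theorem iSeries_jSeries_bounds (hα : IsHJExpansion n a α) (hn : 0 < n) (ha : 0 < a) {t : ℕ}
    (ht1 : 1 ≤ t) (ht : t ≤ α.length) : 1 ≤ iSeries n a α t ∧ iSeries n a α t < n ∧
      1 ≤ jSeries α t ∧ jSeries α t < n := by
  have hdet := det_series n a α t
  obtain ⟨hi0, hi⟩ := iSeries_lt hα hn ha t ht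
  obtain ⟨-, hj⟩ := jSeries_lt hα.1 t ht
  obtain ⟨t, rfl⟩ := Nat.exists_eq_add_of_le' ht1
  obtain ⟨hj0, hj1⟩ := jSeries_lt hα.1 t (by omega)
  refine ⟨by omega, by nlinarith, by omega, by nlinarith⟩

theorem modEq_of_dvd_series {t i j : ℕ} (hi : iSeries n a α t = i) (hj : jSeries α t = j) :
    a * j ≡ i [MOD n] := by
  have := dvd_iSeries_sub n a α t
  rw [hi, hj] at this
  rw [Nat.modEq_iff_dvd]
  push_cast
  exact this

/-- A point (u, v) in the box would put the lattice point (u, j_t - v) into the strip of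
`jSeries_succ_le`, giving j_{t+1} ≤ j_t - v against j_t < j_{t+1}. -/
theorem le_or_le_of_modEq (hα : IsHJExpansion n a α) (hn : 0 < n) (ha : 0 < a) {t i j : ℕ}
    (ht : t ≤ α.length) (hi : iSeries n a α t = i) (hj : jSeries α t = j) {u v : ℕ}
    (h : u + a * v ≡ i [MOD n]) : i ≤ u ∨ j ≤ v := by
  by_contra! hc
  have h1 := dvd_iSeries_sub n a α t
  rw [hi, hj] at h1
  rw [Nat.modEq_iff_dvd] at h
  push_cast at h
  have h2 := jSeries_succ_le hα hn ha ht (u := u) (w := j - v)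
    (by
      obtain ⟨c, hc⟩ := h1
      obtain ⟨e, he⟩ := h
      exact ⟨c - e, by linear_combination hc - he⟩) (by omega) (by omega) (by omega)
  have h3 := (jSeries_lt hα.1 t ht).2
  omega

/-- The empty box leaves only the edges u + 1 = i_t and v + 1 = j_t. There n would divide the other
coordinate, which is positive and below n. -/
theorem le_or_le_of_modEq_succ (hα : IsHJExpansion n a α) (hn : 0 < n) (ha : 0 < a)
    (hcop : Nat.Coprime a n) {t i j : ℕ} (ht1 : 1 ≤ t) (ht : t ≤ α.length)
    (hi : iSeries n a α t = i) (hj : jSeries α t = j) {u v : ℕ}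
    (h : (u + 1) + a * (v + 1) ≡ i [MOD n]) : i ≤ u ∨ j ≤ v := by
  have hb := iSeries_jSeries_bounds hα hn ha ht1 ht
  rw [hi, hj] at hb
  by_contra! hc
  rcases le_or_le_of_modEq hα hn ha ht hi hj h with h1 | h1
  · have h2 : u + 1 = i := by omega
    rw [h2] at h
    have h3 : a * (v + 1) ≡ 0 [MOD n] := Nat.ModEq.add_left_cancel' i (by simpa using h)
    rw [Nat.modEq_zero_iff_dvd] at h3
    have := Nat.le_of_dvd (by omega) (hcop.symm.dvd_of_dvd_mul_left h3)
    omega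
  · have h2 : v + 1 = j := by omega
    rw [h2] at h
    have h3 : u + 1 ≡ 0 [MOD n] := by
      refine Nat.ModEq.add_right_cancel (modEq_of_dvd_series hi hj) ?_
      simpa using h
    rw [Nat.modEq_zero_iff_dvd] at h3
    have := Nat.le_of_dvd (by omega) h3
    omega

/-- Since i_{r+1} = 0, the determinant is i_r j_{r+1} = n, while n divides a j_{r+1} and hence
j_{r+1}. -/
theorem iSeries_length (hα : IsHJExpansion n a α) (hn : 0 < n) (ha : 0 < a)
    (hcop : Nat.Coprime a n) : iSeries n a α α.length = 1 := by
  have hpos := length_pos_of_isHJExpansion hα hn ha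
  have h1 := dvd_iSeries_sub n a α (α.length + 1)
  have hdet := det_series n a α α.length
  rw [iSeries_length_succ hα hn ha] at h1 hdet
  have hb := iSeries_jSeries_bounds hα hn ha hpos le_rfl
  have hj := (jSeries_lt hα.1 α.length le_rfl)
  have h2 : (n : ℤ) ∣ jSeries α (α.length + 1) := by
    refine IsCoprime.dvd_of_dvd_mul_left (Nat.isCoprime_iff_coprime.2 hcop.symm) ?_
    rw [← dvd_neg]
    simpa using h1
  have h3 := Int.le_of_dvd (by omega) h2
  by_contra hne
  have h4 : 2 ≤ iSeries n a α α.length := by omega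
  nlinarith

/-- If no point of weight `s` lies in the box `[0, s) × [0, j)`, where `a j ≡ s`, then `s` is a
member of the `i`-series. -/
theorem exists_iSeries_eq (hα : IsHJExpansion n a α) (hn : 0 < n) (ha : 0 < a)
    (hcop : Nat.Coprime a n) {s j : ℕ} (hs : 0 < s) (hsn : s < n) (hj0 : 0 < j)
    (hj : a * j ≡ s [MOD n])
    (hbox : ∀ u v, u < s → v < j → ¬ u + a * v ≡ s [MOD n]) :
    ∃ t, 1 ≤ t ∧ t ≤ α.length ∧ iSeries n a α t = s := by
  classical
  -- Take the first t with i_t ≤ s. If i_t < s, the point (i_t, j - j_t) has weight s and lies in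
  -- the box.
  have hex : ∃ t, iSeries n a α t ≤ s :=
    ⟨α.length, by rw [iSeries_length hα hn ha hcop]; omega⟩
  obtain ⟨t, ht⟩ : ∃ t, Nat.find hex = t := ⟨_, rfl⟩
  have h1 : iSeries n a α t ≤ s := ht ▸ Nat.find_spec hex
  have htl : t ≤ α.length := by
    rw [← ht]
    exact Nat.find_min' hex (by rw [iSeries_length hα hn ha hcop]; omega)
  cases t with
  | zero => simp only [iSeries] at h1; omega
  | succ t =>
    have h2 : (s : ℤ) < iSeries n a α t := by
      have := Nat.find_min hex (m := t) (by omega)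
      omega
    refine ⟨t + 1, by omega, htl, ?_⟩
    by_contra hne
    have h3 : (a : ℤ) * j ≡ s [ZMOD n] := by exact_mod_cast (Int.natCast_modEq_iff.2 hj)
    have h4 := jSeries_succ_le hα hn ha (t := t) (by omega) (u := s) (w := j)
      h3.dvd (by omega) h2 (by omega)
    obtain ⟨hb1, -, hb2, -⟩ := iSeries_jSeries_bounds hα hn ha (t := t + 1) (by omega) htl
    obtain ⟨u, hu⟩ := Int.eq_ofNat_of_zero_le (a := iSeries n a α (t + 1)) (by omega)
    obtain ⟨v, hv⟩ := Int.eq_ofNat_of_zero_le (a := j - jSeries α (t + 1)) (by omega)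
    refine hbox u v (by omega) (by omega) ?_
    rw [Nat.modEq_iff_dvd]
    push_cast
    rw [← hu, ← hv]
    have h5 := dvd_iSeries_sub n a α (t + 1)
    obtain ⟨c, hc⟩ := h3.dvd
    obtain ⟨e, he⟩ := h5
    exact ⟨c - e, by linear_combination hc - he⟩

theorem exists_mul_modEq (hcop : Nat.Coprime a n) (hn : 0 < n) (s : ℕ) :
    ∃ j, a * j ≡ s [MOD n] := by
  have : NeZero n := ⟨hn.ne'⟩
  refine ⟨((ZMod.unitOfCoprime a hcop)⁻¹ * (s : ZMod n) : ZMod n).val, ?_⟩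
  rw [← ZMod.natCast_eq_natCast_iff]
  push_cast
  rw [ZMod.natCast_zmod_val, ← ZMod.coe_unitOfCoprime a hcop, ← mul_assoc, Units.mul_inv, one_mul]

end ContinuedFraction

/-! ### Special modules belong to the i-series -/

section Classification
variable {k : Type*} [Field k] {n a : ℕ} {ζ : k} {α : List ℕ}

theorem exists_iSeries_eq_of_isSpecial [NeZero n] (hζ : IsPrimitiveRoot ζ n)
    (hα : IsHJExpansion n a α) (ha : 0 < a) (hcop : Nat.Coprime a n) {s : ℕ} (hsn : s < n)
    (hspec : IsSpecial (invRing ζ a) (canonicalModule ζ a) (semiInv ζ a s))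
    (hfree : ¬ Module.Free (invRing ζ a) (semiInv ζ a s)) :
    ∃ t, 1 ≤ t ∧ t ≤ α.length ∧ iSeries n a α t = s := by
  classical
  have hn := NeZero.pos n
  have hs : 0 < s := by
    rcases Nat.eq_zero_or_pos s with rfl | h
    · exact absurd (free_semiInv_zero ζ a) hfree
    · exact h
  have hex := exists_mul_modEq hcop hn s
  have hj := Nat.find_spec hex
  have hs0 : ¬ 0 ≡ s [MOD n] := by
    intro h
    have := Nat.ModEq.eq_of_lt_of_lt h hn hsn
    omega
  refine exists_iSeries_eq hα hn ha hcop hs hsn ?_ hj ?_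
  · rw [Nat.pos_iff_ne_zero]
    intro h0
    rw [h0, mul_zero] at hj
    exact hs0 hj
  -- Descent on u: speciality replaces an interior point by one with both coordinates smaller. A
  -- point on an axis contradicts the minimality of j or the bound u < s < n.
  · intro u
    induction u using Nat.strong_induction_on with
    | _ u ih =>
      intro v hu hv h
      rcases Nat.eq_zero_or_pos u with rfl | hu0
      · rw [zero_add] at h
        exact Nat.find_min hex hv h
      rcases Nat.eq_zero_or_pos v with rfl | hv0
      · rw [mul_zero, add_zero] at h
        have := Nat.ModEq.eq_of_lt_of_lt h (by omega) hsn
        omega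
      obtain ⟨u, rfl⟩ := Nat.exists_eq_add_of_le' hu0
      obtain ⟨v, rfl⟩ := Nat.exists_eq_add_of_le' hv0
      obtain ⟨u₁, v₁, h1, h2, h3⟩ := exists_monomial_of_isSpecial hζ hj hspec h
      exact ih u₁ (by omega) v₁ (by omega) (by omega) h3

end Classification

/-! ### Counting exponents of given weight in boxes -/

section Counting

theorem count_modEq_bounds {n : ℕ} (hn : 0 < n) (q v : ℕ) :
    q / n ≤ ((Finset.range q).filter (· ≡ v [MOD n])).card ∧
      ((Finset.range q).filter (· ≡ v [MOD n])).card ≤ q / n + 1 := by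
  rw [← Nat.count_eq_card_filter_range, Nat.count_modEq_card _ hn]
  split_ifs <;> omega

theorem count_fst_bounds {n : ℕ} (hn : 0 < n) (q w s : ℕ) :
    q / n ≤ ((Finset.range q).filter fun c => c + w ≡ s [MOD n]).card ∧
      ((Finset.range q).filter fun c => c + w ≡ s [MOD n]).card ≤ q / n + 1 := by
  have h : ∀ c, c + w ≡ s [MOD n] ↔ c ≡ s + (n - 1) * w [MOD n] := by
    intro c
    -- (n - 1) * w stands for -w.
    have h1 : s ≡ s + (n - 1) * w + w [MOD n] := by
      obtain ⟨l, hl⟩ := Nat.exists_eq_add_of_le' hn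
      rw [hl, Nat.add_sub_cancel, add_assoc, ← Nat.succ_mul]
      simp [Nat.ModEq]
    exact ⟨fun h => Nat.ModEq.add_right_cancel' w (h.trans h1),
      fun h => (h.add_right w).trans h1.symm⟩
  simp_rw [h]
  exact count_modEq_bounds hn q _

theorem count_snd_bounds {n a : ℕ} (hn : 0 < n) (hcop : Nat.Coprime a n) (q w s : ℕ) :
    q / n ≤ ((Finset.range q).filter fun d => w + a * d ≡ s [MOD n]).card ∧
      ((Finset.range q).filter fun d => w + a * d ≡ s [MOD n]).card ≤ q / n + 1 := by
  obtain ⟨v, hv⟩ := exists_mul_modEq hcop hn (s + (n - 1) * w)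
  have h : ∀ d, w + a * d ≡ s [MOD n] ↔ d ≡ v [MOD n] := by
    intro d
    have h1 : s ≡ w + a * v [MOD n] := by
      refine Nat.ModEq.trans ?_ (hv.add_left w).symm
      obtain ⟨l, hl⟩ := Nat.exists_eq_add_of_le' hn
      rw [hl, Nat.add_sub_cancel, show w + (s + l * w) = s + (l + 1) * w by ring]
      simp [Nat.ModEq]
    constructor
    · intro h
      exact Nat.ModEq.cancel_left_of_coprime (by rwa [Nat.gcd_comm])
        (Nat.ModEq.add_left_cancel' w (h.trans h1))
    · intro h
      exact ((h.mul_left a).add_left w).trans h1.symm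
  simp_rw [h]
  exact count_modEq_bounds hn q _

/-- The exponents in a finite set that have weight `s`. -/
def wtFilter (n a s : ℕ) (T : Finset (ℕ × ℕ)) : Finset (ℕ × ℕ) :=
  T.filter fun c => c.1 + a * c.2 ≡ s [MOD n]

theorem mem_wtFilter {n a s : ℕ} {T : Finset (ℕ × ℕ)} {c : ℕ × ℕ} :
    c ∈ wtFilter n a s T ↔ c ∈ T ∧ c.1 + a * c.2 ≡ s [MOD n] := Finset.mem_filter

theorem card_wtFilter_product (n a s : ℕ) (U V : Finset ℕ) :
    (wtFilter n a s (U ×ˢ V)).card =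
      ∑ u ∈ U, (V.filter fun v => u + a * v ≡ s [MOD n]).card := by
  simp only [wtFilter, Finset.card_filter, Finset.sum_product]

theorem card_wtFilter_product' (n a s : ℕ) (U V : Finset ℕ) :
    (wtFilter n a s (U ×ˢ V)).card =
      ∑ v ∈ V, (U.filter fun u => u + a * v ≡ s [MOD n]).card := by
  simp only [wtFilter, Finset.card_filter, Finset.sum_product_right]

theorem card_wtFilter_le {n a : ℕ} (hn : 0 < n) (hcop : Nat.Coprime a n) (s q : ℕ) (U : Finset ℕ) :
    (wtFilter n a s (U ×ˢ Finset.range q)).card ≤ U.card * (q / n + 1) := by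
  rw [card_wtFilter_product, ← smul_eq_mul]
  exact Finset.sum_le_card_nsmul _ _ _ fun u _ => (count_snd_bounds hn hcop q u s).2

theorem card_wtFilter_le' {n : ℕ} (hn : 0 < n) (a s q : ℕ) (V : Finset ℕ) :
    (wtFilter n a s (Finset.range q ×ˢ V)).card ≤ V.card * (q / n + 1) := by
  rw [card_wtFilter_product', ← smul_eq_mul]
  exact Finset.sum_le_card_nsmul _ _ _ fun v _ => (count_fst_bounds hn q (a * v) s).2

theorem le_card_wtFilter {n : ℕ} (hn : 0 < n) (a s q : ℕ) (V : Finset ℕ) :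
    V.card * (q / n) ≤ (wtFilter n a s (Finset.range q ×ˢ V)).card := by
  rw [card_wtFilter_product', ← smul_eq_mul]
  exact Finset.card_nsmul_le_sum _ _ _ fun v _ => (count_fst_bounds hn q (a * v) s).1

theorem le_card_wtFilter_fst {n a : ℕ} (hn : 0 < n) (hcop : Nat.Coprime a n) (s q : ℕ)
    (U : Finset ℕ) : U.card * (q / n) ≤ (wtFilter n a s (U ×ˢ Finset.range q)).card := by
  rw [card_wtFilter_product, ← smul_eq_mul]
  exact Finset.card_nsmul_le_sum _ _ _ fun u _ => (count_snd_bounds hn hcop q u s).1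

end Counting

/-- The exponent of `x ^ u y ^ v`. -/
def expo (c : ℕ × ℕ) : Fin 2 →₀ ℕ := Finsupp.single 0 c.1 + Finsupp.single 1 c.2

@[simp] theorem expo_zero (c : ℕ × ℕ) : expo c 0 = c.1 := by simp [expo]
@[simp] theorem expo_one (c : ℕ × ℕ) : expo c 1 = c.2 := by simp [expo]

theorem expo_eta (m : Fin 2 →₀ ℕ) : expo (m 0, m 1) = m := by
  ext i
  fin_cases i
  · exact expo_zero _
  · exact expo_one _

theorem expo_injective : Function.Injective expo := fun c d h =>
  Prod.ext (by simpa using DFunLike.congr_fun h 0) (by simpa using DFunLike.congr_fun h 1)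

theorem HasWt.monomial_expo {k : Type*} [Field k] {n a s : ℕ} {c : ℕ × ℕ}
    (h : c.1 + a * c.2 ≡ s [MOD n]) (r : k) : HasWt n a s (MvPowerSeries.monomial (expo c) r) := by
  classical
  intro m hm
  rw [coeff_monomial] at hm
  split_ifs at hm with h1
  · rw [h1]; simpa using h
  · exact absurd rfl hm

/-! ### Upper bounds for the F-surjective numbers -/

section Frobenius

/-- The identity map from `M` to its Frobenius twist. -/
def toTwist (p e : ℕ) (M : Type*) [AddCommGroup M] : M ≃+ FrobTwist p e M := AddEquiv.refl M

theorem smul_toTwist {R : Type*} [CommRing R] (p e : ℕ) [ExpChar R p] {M : Type*}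
    [AddCommGroup M] [Module R M] (r : R) (m : M) :
    r • toTwist p e M m = toTwist p e M (r ^ p ^ e • m) := rfl

variable {k : Type*} [Field k] {p : ℕ} [Fact p.Prime] [CharP k p] {n a : ℕ} [NeZero n] {ζ : k}

set_option synthInstance.maxHeartbeats 200000 in
-- For c = 0, one would like ψ(x^{uq} f₁) = x^u ψ(f₁), but x^u need not be invariant nor f₁ of
-- weight s. Choose y^l of the same weight as x^u; then g = y^{lq} f₁ has weight s. Both monomials
-- become invariant after multiplication by x^{u(n-1)}, so linearity gives y^l ψ(f) = x^u ψ(g), and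
-- x^u is coprime to y^l.
theorem X_pow_dvd_map_toTwist (hζ : IsPrimitiveRoot ζ n) (hcop : Nat.Coprime a n) {e s i : ℕ}
    (ψ : FrobTwist p e (semiInv ζ a s) →ₗ[invRing ζ a] semiInv ζ a i) (c : Fin 2) (u : ℕ)
    (f : semiInv ζ a s) (hf : X c ^ (u * p ^ e) ∣ (f : PS k)) :
    X c ^ u ∣ (ψ (toTwist p e _ f) : PS k) := by
  obtain ⟨c', l, w, hcc, hw, hl⟩ : ∃ (c' : Fin 2) (l w : ℕ), c ≠ c' ∧
      HasWt n a w (X c ^ u : PS k) ∧ HasWt n a w (X c' ^ l : PS k) := by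
    fin_cases c
    · obtain ⟨l, hl⟩ := exists_mul_modEq hcop (NeZero.pos n) u
      exact ⟨1, l, u, by decide, HasWt.X0_pow u, (HasWt.X1_pow l).congr hl⟩
    · exact ⟨0, a * u, a * u, by decide, HasWt.X1_pow u, HasWt.X0_pow _⟩
  obtain ⟨m, hm⟩ := Nat.exists_eq_add_of_le' (NeZero.one_le (n := n))
  obtain ⟨f₁, hf₁⟩ := hf
  have hzero : m * w + w ≡ 0 [MOD n] := by
    rw [← Nat.succ_mul, Nat.succ_eq_add_one, ← hm]; simp [Nat.ModEq]
  have hwf : HasWt n a (s + p ^ e * (m * w)) f₁ := by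
    have h1 := (mem_semiInv_iff hζ).1 f.2
    rw [hf₁] at h1
    have h2 := hw.pow (p ^ e)
    rw [← pow_mul] at h2
    refine h1.of_X_pow_mul h2 ?_
    have := (hzero.mul_left (p ^ e)).add_left s
    rw [mul_zero, add_zero] at this
    convert this using 1
    ring
  have hwg : HasWt n a s ((X c' ^ l) ^ p ^ e * f₁) := by
    refine ((hl.pow (p ^ e)).mul hwf).congr ?_
    have := (hzero.mul_left (p ^ e)).add_left s
    rw [mul_zero, add_zero] at this
    convert this using 1
    ring
  let r₁ : invRing ζ a := ⟨(X c ^ u) ^ m * X c ^ u, (mem_invRing_iff hζ).2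
    (((hw.pow m).mul hw).congr hzero)⟩
  let r₂ : invRing ζ a := ⟨(X c ^ u) ^ m * X c' ^ l, (mem_invRing_iff hζ).2
    (((hw.pow m).mul hl).congr hzero)⟩
  let g : semiInv ζ a s := ⟨(X c' ^ l) ^ p ^ e * f₁, (mem_semiInv_iff hζ).2 hwg⟩
  have h1 : r₁ • toTwist p e (semiInv ζ a s) g = r₂ • toTwist p e (semiInv ζ a s) f := by
    rw [smul_toTwist, smul_toTwist]
    congr 1
    refine Subtype.ext ?_
    change ((X c ^ u) ^ m * X c ^ u) ^ p ^ e * ((X c' ^ l) ^ p ^ e * f₁) =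
      ((X c ^ u) ^ m * X c' ^ l) ^ p ^ e * (f : PS k)
    rw [hf₁, pow_mul, mul_pow, mul_pow]
    ring
  have h2 := congrArg ψ h1
  rw [map_smul, map_smul] at h2
  have h3 : ((X c ^ u) ^ m * X c ^ u : PS k) * (ψ (toTwist p e _ g) : PS k) =
      ((X c ^ u) ^ m * X c' ^ l) * (ψ (toTwist p e _ f) : PS k) := congrArg Subtype.val h2
  rw [mul_assoc, mul_assoc] at h3
  have h4 := mul_left_cancel₀ (pow_ne_zero m (X_pow_ne_zero c u)) h3
  exact X_pow_dvd_of_dvd_X_pow_mul hcc ⟨_, h4.symm⟩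

theorem coeff_map_toTwist_eq_zero (hζ : IsPrimitiveRoot ζ n) (hcop : Nat.Coprime a n) {e s i : ℕ}
    (ψ : FrobTwist p e (semiInv ζ a s) →ₗ[invRing ζ a] semiInv ζ a i) (c : Fin 2) (u : ℕ)
    (f : semiInv ζ a s) (hf : ∀ m, coeff m (f : PS k) ≠ 0 → u * p ^ e ≤ m c)
    {m : Fin 2 →₀ ℕ} (hm : m c < u) : coeff m (ψ (toTwist p e _ f) : PS k) = 0 := by
  refine coeff_eq_zero_of_X_pow_dvd (X_pow_dvd_map_toTwist hζ hcop ψ c u f ?_) hm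
  rw [X_pow_dvd_iff]
  intro m hm
  by_contra h
  have := hf m h
  omega

/-- The part of a semi-invariant consisting of the monomials that satisfy `P`. -/
def semiFilt (hζ : IsPrimitiveRoot ζ n) {s : ℕ} (P : (Fin 2 →₀ ℕ) → Prop) (f : semiInv ζ a s) :
    semiInv ζ a s := ⟨filt P f, (mem_semiInv_iff hζ).2 (((mem_semiInv_iff hζ).1 f.2).filt P)⟩

theorem coeff_semiFilt_ne_zero (hζ : IsPrimitiveRoot ζ n) {s : ℕ} {P : (Fin 2 →₀ ℕ) → Prop}
    {f : semiInv ζ a s} {m : Fin 2 →₀ ℕ} (h : coeff m (semiFilt hζ P f : PS k) ≠ 0) :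
    P m ∧ coeff m (f : PS k) ≠ 0 := by
  change coeff m (filt P (f : PS k)) ≠ 0 at h
  rw [coeff_filt] at h
  by_contra hc
  rw [not_and_or, not_not] at hc
  rcases hc with hc | hc
  · rw [if_neg hc] at h; exact h rfl
  · rw [hc, ite_self] at h; exact h rfl

theorem coeff_map_toTwist_split (hζ : IsPrimitiveRoot ζ n) {e s i : ℕ}
    (ψ : FrobTwist p e (semiInv ζ a s) →ₗ[invRing ζ a] semiInv ζ a i) (P : (Fin 2 →₀ ℕ) → Prop)
    (f : semiInv ζ a s) {m : Fin 2 →₀ ℕ}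
    (h₁ : coeff m (ψ (toTwist p e _ (semiFilt hζ P f)) : PS k) = 0)
    (h₂ : coeff m (ψ (toTwist p e _ (semiFilt hζ (fun m => ¬ P m) f)) : PS k) = 0) :
    coeff m (ψ (toTwist p e _ f) : PS k) = 0 := by
  have h : f = semiFilt hζ P f + semiFilt hζ (fun m => ¬ P m) f :=
    Subtype.ext (filt_add_filt_not P (f : PS k)).symm
  rw [h, map_add, map_add]
  change coeff m ((ψ (toTwist p e _ (semiFilt hζ P f)) : PS k) +
    (ψ (toTwist p e _ (semiFilt hζ (fun m => ¬ P m) f)) : PS k)) = 0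
  rw [map_add, h₁, h₂, add_zero]

/-- If the coefficients at the exponents in `D` of all images of `f` are determined by the
coefficients of `f` at the exponents in `T`, then a surjection onto `M_i ^ m` forces
`m |D| ≤ |T_s|`, where `T_s` consists of the exponents of weight `s` in `T`. -/
theorem mul_card_le_of_surjective [IsAlgClosed k] (hζ : IsPrimitiveRoot ζ n) {e s i m : ℕ}
    (φ : FrobTwist p e (semiInv ζ a s) →ₗ[invRing ζ a] (Fin m → semiInv ζ a i))
    (hφ : Function.Surjective φ) (D T : Finset (ℕ × ℕ)) (hD : ∀ c ∈ D, c.1 + a * c.2 ≡ i [MOD n])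
    (hT : ∀ (ψ : FrobTwist p e (semiInv ζ a s) →ₗ[invRing ζ a] semiInv ζ a i) (f : semiInv ζ a s),
      (∀ c ∈ T, coeff (expo c) (f : PS k) = 0) →
        ∀ c ∈ D, coeff (expo c) (ψ (toTwist p e _ f) : PS k) = 0) :
    m * D.card ≤ (wtFilter n a s T).card := by
  classical
  -- Φ collects the coefficients at D of all m components. It is only semilinear: scaling the source
  -- by c ^ p ^ e scales the value by c.
  let Φ : semiInv ζ a s →+ (Fin m × D → k) :=
    { toFun := fun f l => coeff (expo l.2) (φ (toTwist p e _ f) l.1 : PS k)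
      map_zero' := by
        funext l
        rw [map_zero, map_zero]
        exact coeff_zero _
      map_add' := fun f g => by
        funext l
        rw [map_add, map_add]
        exact map_add (coeff (expo l.2)) _ _ }
  have hΦapp : ∀ f l, Φ f l = coeff (expo l.2) (φ (toTwist p e _ f) l.1 : PS k) := fun _ _ => rfl
  have hsmul : ∀ (c : k) (f : semiInv ζ a s),
      Φ (algebraMap k (invRing ζ a) c ^ p ^ e • f) = c • Φ f := by
    intro c f
    funext l
    rw [hΦapp, ← smul_toTwist, map_smul]
    change coeff (expo l.2) (MvPowerSeries.C c * (φ (toTwist p e _ f) l.1 : PS k)) = _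
    rw [coeff_C_mul]
    rfl
  have hzero : ∀ f : semiInv ζ a s, (∀ c ∈ T, coeff (expo c) (f : PS k) = 0) → Φ f = 0 := by
    intro f hf
    funext l
    exact hT ((LinearMap.proj l.1).comp φ) f hf l.2 l.2.2
  have hsurj : Function.Surjective Φ := by
    intro v
    obtain ⟨z, hz⟩ := hφ fun l => ∑ c : D, (⟨MvPowerSeries.monomial (expo c) (v (l, c)),
      (mem_semiInv_iff hζ).2 (HasWt.monomial_expo (hD c c.2) _)⟩ : semiInv ζ a i)
    refine ⟨(toTwist p e _).symm z, ?_⟩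
    funext l
    rw [hΦapp, AddEquiv.apply_symm_apply, hz, AddSubmonoidClass.coe_finsetSum, map_sum,
      Finset.sum_eq_single l.2]
    · exact coeff_monomial_same _ _
    · intro c _ hc
      exact coeff_monomial_ne (fun h => hc (Subtype.ext (expo_injective h)).symm) _
    · simp
  -- The default value 0 is never used, since only exponents of weight s occur.
  let mono : ℕ × ℕ → k → semiInv ζ a s := fun c r =>
    if h : c.1 + a * c.2 ≡ s [MOD n] then
      ⟨MvPowerSeries.monomial (expo c) r, (mem_semiInv_iff hζ).2 (HasWt.monomial_expo h _)⟩
    else 0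
  have hmono : ∀ c r, c.1 + a * c.2 ≡ s [MOD n] →
      (mono c r : PS k) = MvPowerSeries.monomial (expo c) r := by
    intro c r h
    simp only [mono, dif_pos h]
  have hspan : Submodule.span k (((wtFilter n a s T).image fun c => Φ (mono c 1) :
      Finset (Fin m × D → k)) : Set (Fin m × D → k)) = ⊤ := by
    rw [eq_top_iff]
    rintro v -
    obtain ⟨f, rfl⟩ := hsurj v
    set g : semiInv ζ a s := ∑ c ∈ wtFilter n a s T, mono c (coeff (expo c) (f : PS k)) with hg
    have hfg : Φ f = Φ g := by
      rw [← sub_eq_zero, ← map_sub]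
      refine hzero _ fun c hc => ?_
      change coeff (expo c) ((f : PS k) - (g : PS k)) = 0
      rw [map_sub, sub_eq_zero, hg, AddSubmonoidClass.coe_finsetSum, map_sum]
      by_cases hcs : c.1 + a * c.2 ≡ s [MOD n]
      · rw [Finset.sum_eq_single c]
        · rw [hmono _ _ hcs, coeff_monomial_same]
        · intro d hd hdc
          rw [hmono _ _ (mem_wtFilter.1 hd).2]
          exact coeff_monomial_ne (fun h => hdc (expo_injective h).symm) _
        · intro h
          exact absurd (mem_wtFilter.2 ⟨hc, hcs⟩) h
      · have h0 : coeff (expo c) (f : PS k) = 0 := by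
          by_contra h
          exact hcs (by simpa using (mem_semiInv_iff hζ).1 f.2 _ h)
        rw [h0]
        refine (Finset.sum_eq_zero fun d hd => ?_).symm
        rw [hmono _ _ (mem_wtFilter.1 hd).2]
        refine coeff_monomial_ne (fun h => hcs ?_) _
        rw [expo_injective h]
        exact (mem_wtFilter.1 hd).2
    rw [hfg, hg, map_sum]
    refine Submodule.sum_mem _ fun c hc => ?_
    -- Because of semilinearity a p^e-th root of the coefficient is needed to write the value as a
    -- k-multiple of that of a monomial.
    obtain ⟨r, hr⟩ := IsAlgClosed.exists_pow_nat_eq (coeff (expo c) (f : PS k))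
      (pow_pos (Fact.out (p := p.Prime)).pos e)
    have h1 : mono c (coeff (expo c) (f : PS k)) =
        algebraMap k (invRing ζ a) r ^ p ^ e • mono c 1 := by
      refine Subtype.ext ?_
      change _ = (MvPowerSeries.C r ^ p ^ e) * (mono c 1 : PS k)
      rw [hmono _ _ (mem_wtFilter.1 hc).2, hmono _ _ (mem_wtFilter.1 hc).2, ← hr, ← map_pow,
        ← MvPowerSeries.smul_eq_C_mul, ← map_smul, smul_eq_mul, mul_one]
    rw [h1, hsmul]
    exact Submodule.smul_mem _ _ (Submodule.subset_span
      (Finset.mem_coe.2 (Finset.mem_image_of_mem _ hc)))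
  have h1 := finrank_span_finset_le_card (R := k) ((wtFilter n a s T).image fun c => Φ (mono c 1))
  rw [Set.finrank, hspan, finrank_top, Module.finrank_fintype_fun_eq_card, Fintype.card_prod,
    Fintype.card_fin, Fintype.card_coe] at h1
  exact h1.trans Finset.card_image_le

/-- Terms with first exponent at least (i+1)q have image divisible by x^{i+1}, terms with second
exponent at least q have image divisible by y; neither affects the coefficient of x^i. -/
theorem le_of_surjective_fst [IsAlgClosed k] (hζ : IsPrimitiveRoot ζ n) (hcop : Nat.Coprime a n)
    {e i m : ℕ} (φ : FrobTwist p e (semiInv ζ a i) →ₗ[invRing ζ a] (Fin m → semiInv ζ a i))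
    (hφ : Function.Surjective φ) : m ≤ (i + 1) * p ^ e * (p ^ e / n + 1) := by
  have h := mul_card_le_of_surjective hζ φ hφ {(i, 0)}
    (Finset.range ((i + 1) * p ^ e) ×ˢ Finset.range (p ^ e)) (by simp [Nat.ModEq]) (by
      intro ψ f hf c hc
      rw [Finset.mem_singleton] at hc
      subst hc
      refine coeff_map_toTwist_split hζ ψ (fun m => (i + 1) * p ^ e ≤ m 0) f ?_ ?_
      · exact coeff_map_toTwist_eq_zero hζ hcop ψ 0 (i + 1) _
          (fun m hm => (coeff_semiFilt_ne_zero hζ hm).1) (by simp)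
      · refine coeff_map_toTwist_eq_zero hζ hcop ψ 1 1 _ (fun m hm => ?_) (by simp)
        obtain ⟨h1, h2⟩ := coeff_semiFilt_ne_zero hζ hm
        by_contra h3
        refine h2 ?_
        rw [← expo_eta m]
        exact hf _ (Finset.mem_product.2 ⟨Finset.mem_range.2 (by simpa using h1),
          Finset.mem_range.2 (by simpa using h3)⟩))
  rw [Finset.card_singleton, mul_one] at h
  refine h.trans ((card_wtFilter_le (NeZero.pos n) hcop i _ _).trans ?_)
  rw [Finset.card_range]

theorem le_of_surjective_snd [IsAlgClosed k] (hζ : IsPrimitiveRoot ζ n) (hcop : Nat.Coprime a n)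
    {e i j m : ℕ} (hj : a * j ≡ i [MOD n])
    (φ : FrobTwist p e (semiInv ζ a i) →ₗ[invRing ζ a] (Fin m → semiInv ζ a i))
    (hφ : Function.Surjective φ) : m ≤ (j + 1) * p ^ e * (p ^ e / n + 1) := by
  have h := mul_card_le_of_surjective hζ φ hφ {(0, j)}
    (Finset.range (p ^ e) ×ˢ Finset.range ((j + 1) * p ^ e)) (by simpa using hj) (by
      intro ψ f hf c hc
      rw [Finset.mem_singleton] at hc
      subst hc
      refine coeff_map_toTwist_split hζ ψ (fun m => (j + 1) * p ^ e ≤ m 1) f ?_ ?_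
      · exact coeff_map_toTwist_eq_zero hζ hcop ψ 1 (j + 1) _
          (fun m hm => (coeff_semiFilt_ne_zero hζ hm).1) (by simp)
      · refine coeff_map_toTwist_eq_zero hζ hcop ψ 0 1 _ (fun m hm => ?_) (by simp)
        obtain ⟨h1, h2⟩ := coeff_semiFilt_ne_zero hζ hm
        by_contra h3
        refine h2 ?_
        rw [← expo_eta m]
        exact hf _ (Finset.mem_product.2 ⟨Finset.mem_range.2 (by simpa using h3),
          Finset.mem_range.2 (by simpa using h1)⟩))
  rw [Finset.card_singleton, mul_one] at h
  refine h.trans ((card_wtFilter_le' (NeZero.pos n) a i _ _).trans ?_)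
  rw [Finset.card_range]

/-- Reading x^i and y^j together requires only the L-shaped union of the two boxes. The second arm
starts at q so that the common square is counted once. -/
theorem two_mul_le_of_surjective [IsAlgClosed k] (hζ : IsPrimitiveRoot ζ n)
    (hcop : Nat.Coprime a n) {e i j m : ℕ} (hi0 : 0 < i) (hj0 : 0 < j) (hj : a * j ≡ i [MOD n])
    (φ : FrobTwist p e (semiInv ζ a i) →ₗ[invRing ζ a] (Fin m → semiInv ζ a i))
    (hφ : Function.Surjective φ) : m * 2 ≤ (i + j + 1) * p ^ e * (p ^ e / n + 1) := by
  classical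
  have hcard : ({(i, 0), (0, j)} : Finset (ℕ × ℕ)).card = 2 :=
    Finset.card_pair (by simp [hi0.ne'])
  have h := mul_card_le_of_surjective hζ φ hφ {(i, 0), (0, j)}
    (Finset.range ((i + 1) * p ^ e) ×ˢ Finset.range (p ^ e) ∪
      Finset.range (p ^ e) ×ˢ Finset.Ico (p ^ e) ((j + 1) * p ^ e)) (by
      intro c hc
      rw [Finset.mem_insert, Finset.mem_singleton] at hc
      rcases hc with rfl | rfl
      · simp [Nat.ModEq]
      · simpa using hj) (by
      intro ψ f hf c hc
      have hsupp : ∀ m, coeff m (f : PS k) ≠ 0 → ¬ (m 0 < (i + 1) * p ^ e ∧ m 1 < p ^ e) ∧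
          ¬ (m 0 < p ^ e ∧ p ^ e ≤ m 1 ∧ m 1 < (j + 1) * p ^ e) := by
        intro m hm
        refine ⟨fun h => hm ?_, fun h => hm ?_⟩ <;> rw [← expo_eta m] <;> refine hf _ ?_
        · exact Finset.mem_union_left _ (Finset.mem_product.2 ⟨Finset.mem_range.2 h.1,
            Finset.mem_range.2 h.2⟩)
        · exact Finset.mem_union_right _ (Finset.mem_product.2 ⟨Finset.mem_range.2 h.1,
            Finset.mem_Ico.2 h.2⟩)
      have hq : p ^ e ≤ (j + 1) * p ^ e := Nat.le_mul_of_pos_left _ (by omega)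
      refine coeff_map_toTwist_split hζ ψ (fun m => (i + 1) * p ^ e ≤ m 0) f ?_ ?_
      · refine coeff_map_toTwist_eq_zero hζ hcop ψ 0 (i + 1) _
          (fun m hm => (coeff_semiFilt_ne_zero hζ hm).1) ?_
        rw [Finset.mem_insert, Finset.mem_singleton] at hc
        rcases hc with rfl | rfl <;> simp
      refine coeff_map_toTwist_split hζ ψ (fun m => (j + 1) * p ^ e ≤ m 1) _ ?_ ?_
      · refine coeff_map_toTwist_eq_zero hζ hcop ψ 1 (j + 1) _
          (fun m hm => (coeff_semiFilt_ne_zero hζ hm).1) ?_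
        rw [Finset.mem_insert, Finset.mem_singleton] at hc
        rcases hc with rfl | rfl <;> simp
      -- What survives both truncations lies outside the L, so both exponents are at least q and the
      -- image is divisible by x and by y.
      have hboth : ∀ c' : Fin 2, ∀ m, coeff m (semiFilt hζ (fun m => ¬ (j + 1) * p ^ e ≤ m 1)
          (semiFilt hζ (fun m => ¬ (i + 1) * p ^ e ≤ m 0) f) : PS k) ≠ 0 → 1 * p ^ e ≤ m c' := by
        intro c' m hm
        obtain ⟨h1, h2⟩ := coeff_semiFilt_ne_zero hζ hm
        obtain ⟨h3, h4⟩ := coeff_semiFilt_ne_zero hζ h2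
        obtain ⟨h5, h6⟩ := hsupp m h4
        rw [one_mul]
        have h7 : p ^ e ≤ m 1 := by
          by_contra h; exact h5 ⟨not_le.1 h3, not_le.1 h⟩
        have h8 : p ^ e ≤ m 0 := by
          by_contra h; exact h6 ⟨not_le.1 h, h7, not_le.1 h1⟩
        fin_cases c'
        · exact h8
        · exact h7
      rw [Finset.mem_insert, Finset.mem_singleton] at hc
      rcases hc with rfl | rfl
      · exact coeff_map_toTwist_eq_zero hζ hcop ψ 1 1 _ (hboth 1) (by simp)
      · exact coeff_map_toTwist_eq_zero hζ hcop ψ 0 1 _ (hboth 0) (by simp))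
  rw [hcard] at h
  refine h.trans ?_
  rw [wtFilter, Finset.filter_union]
  refine (Finset.card_union_le _ _).trans ?_
  have h1 := card_wtFilter_le (NeZero.pos n) hcop i (p ^ e) (Finset.range ((i + 1) * p ^ e))
  have h2 := card_wtFilter_le' (NeZero.pos n) a i (p ^ e) (Finset.Ico (p ^ e) ((j + 1) * p ^ e))
  rw [Finset.card_range] at h1
  rw [Nat.card_Ico, show (j + 1) * p ^ e - p ^ e = j * p ^ e by
    rw [add_mul, one_mul, Nat.add_sub_cancel]] at h2
  refine (add_le_add h1 h2).trans (le_of_eq ?_)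
  ring

end Frobenius

/-! ### Coordinates over the subring of p^e-th powers -/

section Projection
variable {k : Type*} [Field k] {p : ℕ} [Fact p.Prime] [CharP k p]

theorem exists_eq_smul_of_coeff_pow_ne_zero {e : ℕ} {r : PS k} {m : Fin 2 →₀ ℕ}
    (h : coeff m (r ^ p ^ e) ≠ 0) : ∃ u, m = p ^ e • u := by
  have hdvd : ∀ i, p ^ e ∣ m i := by
    intro i
    by_contra hi
    refine h ?_
    rw [← map_iterateFrobenius_expand p (Fact.out (p := p.Prime)).ne_zero r e, coeff_map,
      coeff_expand_of_not_dvd _ _ _ hi, map_zero]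
  obtain ⟨u, hu⟩ := hdvd 0
  obtain ⟨v, hv⟩ := hdvd 1
  refine ⟨expo (u, v), ?_⟩
  ext i
  fin_cases i
  · simpa using hu
  · simpa using hv

variable [PerfectRing k p]

/-- The coefficient of `x ^ c.1 y ^ c.2` in the expansion of a power series over the subring of
`p ^ e`-th powers, as a `p ^ e`-th root. -/
def frobProj (p e : ℕ) [Fact p.Prime] [CharP k p] [PerfectRing k p] (c : ℕ × ℕ) (f : PS k) : PS k :=
  fun m => (iterateFrobeniusEquiv k p e).symm (coeff (p ^ e • m + expo c) f)

theorem coeff_frobProj (e : ℕ) (c : ℕ × ℕ) (f : PS k) (m : Fin 2 →₀ ℕ) :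
    coeff m (frobProj p e c f) =
      (iterateFrobeniusEquiv k p e).symm (coeff (p ^ e • m + expo c) f) := rfl

theorem frobProj_add (e : ℕ) (c : ℕ × ℕ) (f g : PS k) :
    frobProj p e c (f + g) = frobProj p e c f + frobProj p e c g := by
  ext m
  simp only [coeff_frobProj, map_add]

theorem frobProj_sum (e : ℕ) (c : ℕ × ℕ) {ι : Type*} (T : Finset ι) (F : ι → PS k) :
    frobProj p e c (∑ i ∈ T, F i) = ∑ i ∈ T, frobProj p e c (F i) := by
  ext m
  simp only [coeff_frobProj, map_sum]

theorem coeff_smul_pow (e : ℕ) (r : PS k) (m : Fin 2 →₀ ℕ) :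
    coeff (p ^ e • m) (r ^ p ^ e) = iterateFrobeniusEquiv k p e (coeff m r) := by
  rw [← map_iterateFrobenius_expand p (Fact.out (p := p.Prime)).ne_zero r e, coeff_map,
    coeff_expand_smul]
  rfl

/-- A q-th power involves only exponents divisible by q, so the product respects residue classes
modulo q. The bound c < q keeps the quotient of the remaining exponent nonnegative. -/
theorem frobProj_pow_mul (e : ℕ) {c : ℕ × ℕ} (hc : c.1 < p ^ e ∧ c.2 < p ^ e) (r f : PS k) :
    frobProj p e c (r ^ p ^ e * f) = r * frobProj p e c f := by
  classical
  have hq : 0 < p ^ e := pow_pos (Fact.out (p := p.Prime)).pos e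
  ext m
  rw [coeff_frobProj, RingEquiv.symm_apply_eq, MvPowerSeries.coeff_mul, MvPowerSeries.coeff_mul,
    map_sum]
  symm
  refine Finset.sum_of_injOn (fun w => (p ^ e • w.1, p ^ e • w.2 + expo c)) ?_ ?_ ?_ ?_
  · rintro ⟨u, v⟩ - ⟨u', v'⟩ - h
    simp only [Prod.mk.injEq, add_left_inj] at h
    have hinj : Function.Injective fun w : Fin 2 →₀ ℕ => p ^ e • w := fun x y hxy => by
      ext i
      have := DFunLike.congr_fun hxy i
      simp only [Finsupp.smul_apply, smul_eq_mul] at this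
      exact Nat.eq_of_mul_eq_mul_left hq this
    exact Prod.ext (hinj h.1) (hinj h.2)
  · rintro ⟨u, v⟩ h
    simp only [Finset.mem_coe, Finset.HasAntidiagonal.mem_antidiagonal] at h ⊢
    rw [← h, smul_add, add_assoc]
  · rintro ⟨u, v⟩ h hni
    rw [Finset.HasAntidiagonal.mem_antidiagonal] at h
    simp only at h ⊢
    by_contra hne
    obtain ⟨u', rfl⟩ := exists_eq_smul_of_coeff_pow_ne_zero (left_ne_zero_of_mul hne)
    refine hni ?_
    have h0 : p ^ e * u' 0 + v 0 = p ^ e * m 0 + c.1 := by simpa using DFunLike.congr_fun h 0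
    have h1 : p ^ e * u' 1 + v 1 = p ^ e * m 1 + c.2 := by simpa using DFunLike.congr_fun h 1
    have h2 : u' 0 ≤ m 0 := by
      by_contra hcon
      push Not at hcon
      have := Nat.mul_le_mul_left (p ^ e) hcon
      rw [Nat.succ_eq_add_one, mul_add, mul_one] at this
      omega
    have h3 : u' 1 ≤ m 1 := by
      by_contra hcon
      push Not at hcon
      have := Nat.mul_le_mul_left (p ^ e) hcon
      rw [Nat.succ_eq_add_one, mul_add, mul_one] at this
      omega
    refine ⟨(u', expo (m 0 - u' 0, m 1 - u' 1)), ?_, Prod.ext rfl ?_⟩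
    · simp only [Finset.mem_coe, Finset.HasAntidiagonal.mem_antidiagonal]
      ext i
      fin_cases i
      · simp [h2]
      · simp [h3]
    · ext i
      have h4 := Nat.mul_le_mul_left (p ^ e) h2
      have h5 := Nat.mul_le_mul_left (p ^ e) h3
      fin_cases i
      · simp only [Fin.zero_eta, Finsupp.add_apply, Finsupp.smul_apply, expo_zero, smul_eq_mul,
          Nat.mul_sub]
        omega
      · simp only [Fin.mk_one, Finsupp.add_apply, Finsupp.smul_apply, expo_one, smul_eq_mul,
          Nat.mul_sub]
        omega
  · rintro ⟨u, v⟩ -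
    simp only
    rw [coeff_smul_pow, map_mul, coeff_frobProj, RingEquiv.apply_symm_apply]

theorem frobProj_monomial (e : ℕ) {c d : ℕ × ℕ} (hd : d.1 < p ^ e ∧ d.2 < p ^ e) :
    frobProj p e c (MvPowerSeries.monomial (expo d) 1 : PS k) = if c = d then 1 else 0 := by
  classical
  ext m
  rw [coeff_frobProj, coeff_monomial]
  by_cases h : p ^ e • m + expo c = expo d
  · have h0 : p ^ e * m 0 + c.1 = d.1 := by simpa using DFunLike.congr_fun h 0
    have h1 : p ^ e * m 1 + c.2 = d.2 := by simpa using DFunLike.congr_fun h 1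
    have hm0 : m 0 = 0 := by
      by_contra hne
      have := Nat.le_mul_of_pos_right (p ^ e) (Nat.pos_of_ne_zero hne)
      omega
    have hm1 : m 1 = 0 := by
      by_contra hne
      have := Nat.le_mul_of_pos_right (p ^ e) (Nat.pos_of_ne_zero hne)
      omega
    have hm : m = 0 := by
      ext i
      fin_cases i
      · exact hm0
      · exact hm1
    rw [hm0, mul_zero, zero_add] at h0
    rw [hm1, mul_zero, zero_add] at h1
    rw [if_pos h, if_pos (Prod.ext h0 h1), map_one, hm, coeff_zero_one]
  · rw [if_neg h, map_zero]
    split_ifs with hcd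
    · rw [MvPowerSeries.coeff_one, if_neg]
      rintro rfl
      exact h (by rw [hcd, smul_zero, zero_add])
    · rw [coeff_zero]

/-- Coordinates at distinct exponents of [0, q)² can be prescribed independently; this is the source
of surjectivity. -/
theorem frobProj_sum_pow_mul (e : ℕ) {ι : Type*} [Fintype ι] (c : ι → ℕ × ℕ)
    (hc : ∀ i, (c i).1 < p ^ e ∧ (c i).2 < p ^ e) (hinj : Function.Injective c) (g : ι → PS k)
    (i : ι) : frobProj p e (c i)
      (∑ l, g l ^ p ^ e * MvPowerSeries.monomial (expo (c l)) 1) = g i := by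
  classical
  rw [frobProj_sum, Finset.sum_eq_single i]
  · rw [frobProj_pow_mul e (hc i), frobProj_monomial e (hc i), if_pos rfl, mul_one]
  · intro l _ hl
    rw [frobProj_pow_mul e (hc i), frobProj_monomial e (hc l), if_neg fun h => hl (hinj h).symm,
      mul_zero]
  · simp

theorem HasWt.frobProj {n a s t e : ℕ} (hnp : Nat.Coprime n p) {f : PS k} (hf : HasWt n a s f)
    {c : ℕ × ℕ} (h : p ^ e * t + (c.1 + a * c.2) ≡ s [MOD n]) :
    HasWt n a t (frobProj p e c f) := by
  intro m hm
  have h1 := hf (p ^ e • m + expo c) fun h0 => hm (by rw [coeff_frobProj, h0, map_zero])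
  have h2 := h1.trans h.symm
  simp only [Finsupp.add_apply, Finsupp.smul_apply, smul_eq_mul, expo_zero, expo_one] at h2
  have h3 : p ^ e * (m 0 + a * m 1) ≡ p ^ e * t [MOD n] := by
    refine Nat.ModEq.add_right_cancel' (c.1 + a * c.2) ?_
    convert h2 using 1
    ring
  exact Nat.ModEq.cancel_left_of_coprime (hnp.pow_right e) h3

variable {n a : ℕ} [NeZero n] {ζ : k}

/-- The map `f ↦ h π_c(f)` from the Frobenius twist of `M_s` to `M_i`. -/
def frobProjMap (hζ : IsPrimitiveRoot ζ n) (hnp : Nat.Coprime n p) {e s t w i : ℕ} {c : ℕ × ℕ}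
    (hc : c.1 < p ^ e ∧ c.2 < p ^ e) (ht : p ^ e * t + (c.1 + a * c.2) ≡ s [MOD n]) {h : PS k}
    (hh : HasWt n a w h) (hw : w + t ≡ i [MOD n]) :
    FrobTwist p e (semiInv ζ a s) →ₗ[invRing ζ a] semiInv ζ a i where
  toFun f := ⟨h * frobProj p e c ((toTwist p e (semiInv ζ a s)).symm f : PS k),
    (mem_semiInv_iff hζ).2 ((hh.mul
      (((mem_semiInv_iff hζ).1 ((toTwist p e (semiInv ζ a s)).symm f).2).frobProj hnp ht)).congr hw)⟩
  map_add' f g := Subtype.ext (by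
    change h * frobProj p e c (((toTwist p e (semiInv ζ a s)).symm f : PS k) +
      ((toTwist p e (semiInv ζ a s)).symm g : PS k)) = _
    rw [frobProj_add, mul_add]
    rfl)
  map_smul' r f := Subtype.ext (by
    change h * frobProj p e c ((r : PS k) ^ p ^ e *
      ((toTwist p e (semiInv ζ a s)).symm f : PS k)) = _
    rw [frobProj_pow_mul e hc, mul_left_comm]
    rfl)

end Projection

/-! ### Exponents as sources, reduced modulo q -/

section Sources
variable {n a : ℕ}

/-- Reduction of the first exponent modulo `q`. -/
def redFst (q : ℕ) (c : ℕ × ℕ) : ℕ × ℕ := (c.1 % q, c.2)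

/-- Reduction of the second exponent modulo `q`. -/
def redSnd (q : ℕ) (c : ℕ × ℕ) : ℕ × ℕ := (c.1, c.2 % q)

theorem weight_redFst {q s : ℕ} {c : ℕ × ℕ} (h : c.1 + a * c.2 ≡ s [MOD n]) :
    q * (c.1 / q) + ((redFst q c).1 + a * (redFst q c).2) ≡ s [MOD n] := by
  simp only [redFst]
  rwa [← add_assoc, Nat.div_add_mod]

theorem weight_redSnd {q s : ℕ} {c : ℕ × ℕ} (h : c.1 + a * c.2 ≡ s [MOD n]) :
    q * (a * (c.2 / q)) + ((redSnd q c).1 + a * (redSnd q c).2) ≡ s [MOD n] := by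
  simp only [redSnd]
  convert h using 1
  conv_rhs => rw [← Nat.div_add_mod c.2 q]
  ring

theorem modEq_of_weight_eq {q s t t' w : ℕ} (hnq : Nat.Coprime n q)
    (h : q * t + w ≡ s [MOD n]) (h' : q * t' + w ≡ s [MOD n]) : t ≡ t' [MOD n] :=
  Nat.ModEq.cancel_left_of_coprime hnq (Nat.ModEq.add_right_cancel' w (h.trans h'.symm))

/-- The weight and the reduced exponent determine the quotient modulo n, as q is prime to n, and the
quotient is at most i < n. -/
theorem redFst_injOn {q s i : ℕ} (hnq : Nat.Coprime n q) (hin : i < n) {c d : ℕ × ℕ}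
    (hc : c.1 < (i + 1) * q) (hd : d.1 < (i + 1) * q) (hcw : c.1 + a * c.2 ≡ s [MOD n])
    (hdw : d.1 + a * d.2 ≡ s [MOD n]) (h : redFst q c = redFst q d) : c = d := by
  have h1 := weight_redFst (q := q) hcw
  have h2 := weight_redFst (q := q) hdw
  rw [← h] at h2
  have h3 := Nat.ModEq.eq_of_lt_of_lt (modEq_of_weight_eq hnq h1 h2)
    (by have := Nat.div_lt_of_lt_mul (by rwa [mul_comm] at hc : c.1 < q * (i + 1)); omega)
    (by have := Nat.div_lt_of_lt_mul (by rwa [mul_comm] at hd : d.1 < q * (i + 1)); omega)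
  simp only [redFst, Prod.mk.injEq] at h
  refine Prod.ext ?_ h.2
  rw [← Nat.div_add_mod c.1 q, h3, h.1, Nat.div_add_mod]

theorem redSnd_injOn {q s j : ℕ} (hnq : Nat.Coprime n q) (hcop : Nat.Coprime a n) (hjn : j < n)
    {c d : ℕ × ℕ} (hc : c.2 < (j + 1) * q) (hd : d.2 < (j + 1) * q)
    (hcw : c.1 + a * c.2 ≡ s [MOD n]) (hdw : d.1 + a * d.2 ≡ s [MOD n])
    (h : redSnd q c = redSnd q d) : c = d := by
  have h1 := weight_redSnd (q := q) hcw
  have h2 := weight_redSnd (q := q) hdw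
  rw [← h] at h2
  have h3 := Nat.ModEq.eq_of_lt_of_lt
    (Nat.ModEq.cancel_left_of_coprime hcop.symm (modEq_of_weight_eq hnq h1 h2))
    (by have := Nat.div_lt_of_lt_mul (by rwa [mul_comm] at hc : c.2 < q * (j + 1)); omega)
    (by have := Nat.div_lt_of_lt_mul (by rwa [mul_comm] at hd : d.2 < q * (j + 1)); omega)
  simp only [redSnd, Prod.mk.injEq] at h
  refine Prod.ext h.1 ?_
  rw [← Nat.div_add_mod c.2 q, h3, h.2, Nat.div_add_mod]

/-- If no point of weight `i` lies in the box `[0, i) × [0, j)`, the reductions of two exponents of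
the same weight agree only for equal exponents. -/
theorem eq_of_redFst_eq_redSnd {q s i j : ℕ} (hi0 : 0 < i) (hnq : Nat.Coprime n q)
    (hj : a * j ≡ i [MOD n]) (hbox : ∀ u v, u + a * v ≡ i [MOD n] → i ≤ u ∨ j ≤ v)
    {c d : ℕ × ℕ} (hc : c.1 < (i + 1) * q) (hd : d.2 < j * q)
    (hcw : c.1 + a * c.2 ≡ s [MOD n]) (hdw : d.1 + a * d.2 ≡ s [MOD n])
    (h : redFst q c = redSnd q d) : c = d := by
  have h1 := weight_redFst (q := q) hcw
  have h2 := weight_redSnd (q := q) hdw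
  rw [← h] at h2
  have h3 := modEq_of_weight_eq hnq h1 h2
  have hci : c.1 / q ≤ i := by
    have := Nat.div_lt_of_lt_mul (by rwa [mul_comm] at hc : c.1 < q * (i + 1)); omega
  have hdj : d.2 / q < j := Nat.div_lt_of_lt_mul (by rwa [mul_comm] at hd : d.2 < q * j)
  -- The quotients t, v satisfy t ≡ a v, so (i - t, v) and (t, j - v) both have weight i. The empty
  -- box, applied to each, leaves t = v = 0.
  obtain ⟨h4, h5⟩ : c.1 / q = 0 ∧ d.2 / q = 0 := by
    generalize c.1 / q = t at *
    generalize d.2 / q = v at *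
    have h5 : (i - t) + a * v ≡ i [MOD n] := by
      have := h3.symm.add_left (i - t)
      rwa [Nat.sub_add_cancel hci] at this
    have h6 : t + a * (j - v) ≡ i [MOD n] := by
      have := h3.add_right (a * (j - v))
      rw [← mul_add, Nat.add_sub_cancel' hdj.le] at this
      exact this.trans hj
    have h7 := hbox _ _ h5
    have h8 := hbox _ _ h6
    omega
  simp only [redFst, redSnd, Prod.mk.injEq] at h
  refine Prod.ext ?_ ?_
  · rw [← Nat.div_add_mod c.1 q, h4, h.1]; simp
  · rw [← Nat.div_add_mod d.2 q, h5, h.2]; simp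

end Sources

/-! ### Construction of surjections -/

section Lower
variable {k : Type*} [Field k] {p : ℕ} [Fact p.Prime] [CharP k p] [PerfectRing k p] {n a : ℕ}
  [NeZero n] {ζ : k}

set_option synthInstance.maxHeartbeats 200000 in
-- A source selects the piece indexed by its residue modulo q. For c in A the piece is M_t with t =
-- ⌊c.1/q⌋, and multiplication by x^{i-t} reaches R x^i; sources in B reach R y^j in the same way.
-- One of each covers a copy of M_i. For E the quotient is i, so the piece is a copy by itself.
theorem exists_surjective_of_sources (hζ : IsPrimitiveRoot ζ n) (hnp : Nat.Coprime n p)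
    (hcop : Nat.Coprime a n) {e s i j : ℕ} (hi0 : 0 < i) (hin : i < n) (hjn : j < n) (hj : a * j ≡ i [MOD n])
    (hbox : ∀ u v, u + a * v ≡ i [MOD n] → i ≤ u ∨ j ≤ v) {m w : ℕ} {A B E : Finset (ℕ × ℕ)}
    (hA : A ⊆ wtFilter n a s (Finset.range (i * p ^ e) ×ˢ Finset.range (p ^ e)))
    (hB : B ⊆ wtFilter n a s (Finset.range (p ^ e) ×ˢ Finset.range (j * p ^ e)))
    (hAB : Disjoint A B)
    (hE : E ⊆ wtFilter n a s
      (Finset.Ico (i * p ^ e) ((i + 1) * p ^ e) ×ˢ Finset.range (p ^ e)))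
    (hmA : m ≤ A.card) (hmB : m ≤ B.card) (hwE : w ≤ E.card) :
    ∃ φ : FrobTwist p e (semiInv ζ a s) →ₗ[invRing ζ a] (Fin (m + w) → semiInv ζ a i),
      Function.Surjective φ := by
  classical
  have hq : 0 < p ^ e := pow_pos (Fact.out (p := p.Prime)).pos e
  have hnq : Nat.Coprime n (p ^ e) := hnp.pow_right e
  let x : Fin m → ℕ × ℕ := fun l => A.equivFin.symm (Fin.castLE hmA l)
  let y : Fin m → ℕ × ℕ := fun l => B.equivFin.symm (Fin.castLE hmB l)
  let z : Fin w → ℕ × ℕ := fun l => E.equivFin.symm (Fin.castLE hwE l)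
  have hx : ∀ l, x l ∈ A := fun l => Subtype.coe_prop _
  have hy : ∀ l, y l ∈ B := fun l => Subtype.coe_prop _
  have hz : ∀ l, z l ∈ E := fun l => Subtype.coe_prop _
  have hxi : Function.Injective x := fun l l' h => by simpa [x, Subtype.coe_inj] using h
  have hyi : Function.Injective y := fun l l' h => by simpa [y, Subtype.coe_inj] using h
  have hzi : Function.Injective z := fun l l' h => by simpa [z, Subtype.coe_inj] using h
  have hx' : ∀ l, ((x l).1 < i * p ^ e ∧ (x l).2 < p ^ e) ∧ (x l).1 + a * (x l).2 ≡ s [MOD n] := by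
    intro l
    simpa [mem_wtFilter] using hA (hx l)
  have hy' : ∀ l, ((y l).1 < p ^ e ∧ (y l).2 < j * p ^ e) ∧ (y l).1 + a * (y l).2 ≡ s [MOD n] := by
    intro l
    simpa [mem_wtFilter] using hB (hy l)
  have hz' : ∀ l, ((i * p ^ e ≤ (z l).1 ∧ (z l).1 < (i + 1) * p ^ e) ∧ (z l).2 < p ^ e) ∧
      (z l).1 + a * (z l).2 ≡ s [MOD n] := by
    intro l
    simpa [mem_wtFilter] using hE (hz l)
  have hle : i * p ^ e ≤ (i + 1) * p ^ e := Nat.mul_le_mul_right _ (by omega)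
  have hlej : j * p ^ e ≤ (j + 1) * p ^ e := Nat.mul_le_mul_right _ (by omega)
  have hxd : ∀ l, (x l).1 / p ^ e ≤ i := fun l =>
    (Nat.div_lt_of_lt_mul (by rw [mul_comm]; exact (hx' l).1.1)).le
  have hyd : ∀ l, (y l).2 / p ^ e ≤ j := fun l =>
    (Nat.div_lt_of_lt_mul (by rw [mul_comm]; exact (hy' l).1.2)).le
  have hzd : ∀ l, (z l).1 / p ^ e = i := fun l =>
    Nat.div_eq_of_lt_le (hz' l).1.1.1 (hz' l).1.1.2
  have hxw : ∀ l, i - (x l).1 / p ^ e + (x l).1 / p ^ e ≡ i [MOD n] := fun l => by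
    rw [Nat.sub_add_cancel (hxd l)]
  have hyw : ∀ l, a * (j - (y l).2 / p ^ e) + a * ((y l).2 / p ^ e) ≡ i [MOD n] := fun l => by
    rw [← mul_add, Nat.sub_add_cancel (hyd l)]; exact hj
  have hzw : ∀ l, 0 + (z l).1 / p ^ e ≡ i [MOD n] := fun l => by rw [zero_add, hzd]
  have hxc : ∀ l, (redFst (p ^ e) (x l)).1 < p ^ e ∧ (redFst (p ^ e) (x l)).2 < p ^ e :=
    fun l => ⟨Nat.mod_lt _ hq, (hx' l).1.2⟩
  have hyc : ∀ l, (redSnd (p ^ e) (y l)).1 < p ^ e ∧ (redSnd (p ^ e) (y l)).2 < p ^ e :=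
    fun l => ⟨(hy' l).1.1, Nat.mod_lt _ hq⟩
  have hzc : ∀ l, (redFst (p ^ e) (z l)).1 < p ^ e ∧ (redFst (p ^ e) (z l)).2 < p ^ e :=
    fun l => ⟨Nat.mod_lt _ hq, (hz' l).1.2⟩
  let cc : (Fin m ⊕ Fin m) ⊕ Fin w → ℕ × ℕ :=
    Sum.elim (Sum.elim (fun l => redFst (p ^ e) (x l)) (fun l => redSnd (p ^ e) (y l)))
      (fun l => redFst (p ^ e) (z l))
  have hcc : ∀ l, (cc l).1 < p ^ e ∧ (cc l).2 < p ^ e := by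
    rintro ((l | l) | l)
    · exact hxc l
    · exact hyc l
    · exact hzc l
  -- Distinct sources select distinct pieces. A source shared by A and B is excluded by
  -- disjointness; one shared by E and B would have quotient i = 0.
  have hccinj : Function.Injective cc := by
    have hxy : ∀ l l', redFst (p ^ e) (x l) ≠ redSnd (p ^ e) (y l') := by
      intro l l' h
      have := eq_of_redFst_eq_redSnd hi0 hnq hj hbox ((hx' l).1.1.trans_le hle) (hy' l').1.2 (hx' l).2
        (hy' l').2 h
      exact Finset.disjoint_left.1 hAB (hx l) (this ▸ hy l')
    have hxz : ∀ l l', redFst (p ^ e) (x l) ≠ redFst (p ^ e) (z l') := by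
      intro l l' h
      have := redFst_injOn hnq hin ((hx' l).1.1.trans_le hle) (hz' l').1.1.2 (hx' l).2 (hz' l').2 h
      have h1 := (hx' l).1.1
      rw [this] at h1
      exact absurd (hz' l').1.1.1 (not_le.2 h1)
    have hzy : ∀ l l', redFst (p ^ e) (z l) ≠ redSnd (p ^ e) (y l') := by
      intro l l' h
      have := eq_of_redFst_eq_redSnd hi0 hnq hj hbox (hz' l).1.1.2 (hy' l').1.2 (hz' l).2
        (hy' l').2 h
      have h1 := hzd l
      rw [this, Nat.div_eq_of_lt (hy' l').1.1] at h1
      omega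
    rintro ((l | l) | l) ((l' | l') | l') h
    · exact congrArg _ (congrArg _ (hxi (redFst_injOn hnq hin ((hx' l).1.1.trans_le hle)
        ((hx' l').1.1.trans_le hle) (hx' l).2 (hx' l').2 h)))
    · exact absurd h (hxy l l')
    · exact absurd h (hxz l l')
    · exact absurd h.symm (hxy l' l)
    · exact congrArg _ (congrArg _ (hyi (redSnd_injOn hnq hcop hjn ((hy' l).1.2.trans_le hlej)
        ((hy' l').1.2.trans_le hlej) (hy' l).2 (hy' l').2 h)))
    · exact absurd h.symm (hzy l' l)
    · exact absurd h.symm (hxz l' l)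
    · exact absurd h (hzy l l')
    · exact congrArg _ (hzi (redFst_injOn hnq hin (hz' l).1.1.2
        (hz' l').1.1.2 (hz' l).2 (hz' l').2 h))
  let φx : Fin m → (FrobTwist p e (semiInv ζ a s) →ₗ[invRing ζ a] semiInv ζ a i) := fun l =>
    frobProjMap hζ hnp (hxc l) (weight_redFst (hx' l).2) (HasWt.X0_pow (i - (x l).1 / p ^ e)) (hxw l)
  let φy : Fin m → (FrobTwist p e (semiInv ζ a s) →ₗ[invRing ζ a] semiInv ζ a i) := fun l =>
    frobProjMap hζ hnp (hyc l) (weight_redSnd (hy' l).2) (HasWt.X1_pow (j - (y l).2 / p ^ e)) (hyw l)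
  let φz : Fin w → (FrobTwist p e (semiInv ζ a s) →ₗ[invRing ζ a] semiInv ζ a i) := fun l =>
    frobProjMap hζ hnp (hzc l) (weight_redFst (hz' l).2) HasWt.one (hzw l)
  let Φ : Fin (m + w) → (FrobTwist p e (semiInv ζ a s) →ₗ[invRing ζ a] semiInv ζ a i) :=
    Fin.append (fun l => φx l + φy l) φz
  refine ⟨LinearMap.pi Φ, fun v => ?_⟩
  have hspan : ∀ f : semiInv ζ a i, ∃ r t : invRing ζ a,
      (f : PS k) = (r : PS k) * X 0 ^ i + (t : PS k) * X 1 ^ j := by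
    intro f
    have := (semiInv_eq_span hζ hj hbox).le f.2
    rw [Submodule.mem_span_pair] at this
    obtain ⟨r, t, h⟩ := this
    exact ⟨r, t, h.symm⟩
  choose r t hrt using hspan
  -- Coordinates of a preimage: for a component r x^i + t y^j each piece receives the part of the
  -- power that its map does not supply.
  let g : (Fin m ⊕ Fin m) ⊕ Fin w → PS k :=
    Sum.elim (Sum.elim (fun l => (r (v (Fin.castAdd w l)) : PS k) * X 0 ^ ((x l).1 / p ^ e))
      (fun l => (t (v (Fin.castAdd w l)) : PS k) * X 1 ^ ((y l).2 / p ^ e)))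
      (fun l => (v (Fin.natAdd m l) : PS k))
  have hterm : ∀ (u : ℕ) (h : PS k) (c : ℕ × ℕ), HasWt n a u h →
      p ^ e * u + (c.1 + a * c.2) ≡ s [MOD n] →
      HasWt n a s (h ^ p ^ e * MvPowerSeries.monomial (expo c) 1) := fun u h c hh hc =>
    ((hh.pow (p ^ e)).mul (HasWt.monomial_expo (Nat.ModEq.refl _) 1)).congr hc
  have hwt : HasWt n a s (∑ l, g l ^ p ^ e * MvPowerSeries.monomial (expo (cc l)) 1) := by
    refine HasWt.sum ?_
    rintro ((l | l) | l) -
    · exact hterm _ _ _ (((hasWt_coe hζ _).mul (HasWt.X0_pow _)).congr (by rw [zero_add]))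
        (weight_redFst (hx' l).2)
    · exact hterm _ _ _ (((hasWt_coe hζ _).mul (HasWt.X1_pow _)).congr (by rw [zero_add]))
        (weight_redSnd (hy' l).2)
    · refine hterm _ _ _ ((mem_semiInv_iff hζ).1 (v (Fin.natAdd m l)).2) ?_
      have := weight_redFst (q := p ^ e) (hz' l).2
      rwa [hzd l] at this
  have hproj := frobProj_sum_pow_mul (p := p) e cc hcc hccinj g
  refine ⟨toTwist p e (semiInv ζ a s) ⟨_, (mem_semiInv_iff hζ).2 hwt⟩, ?_⟩
  funext l
  refine Fin.addCases (fun l => ?_) (fun l => ?_) l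
  · rw [LinearMap.pi_apply]
    simp only [Φ, Fin.append_left]
    refine Subtype.ext ?_
    change X 0 ^ (i - (x l).1 / p ^ e) * frobProj p e (cc (Sum.inl (Sum.inl l))) _ +
      X 1 ^ (j - (y l).2 / p ^ e) * frobProj p e (cc (Sum.inl (Sum.inr l))) _ = _
    rw [AddEquiv.symm_apply_apply, hproj, hproj, hrt (v (Fin.castAdd w l))]
    change X 0 ^ (i - (x l).1 / p ^ e) * ((r (v (Fin.castAdd w l)) : PS k) * X 0 ^ ((x l).1 / p ^ e)) +
      X 1 ^ (j - (y l).2 / p ^ e) * ((t (v (Fin.castAdd w l)) : PS k) * X 1 ^ ((y l).2 / p ^ e)) = _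
    rw [mul_left_comm, ← pow_add, Nat.sub_add_cancel (hxd l), mul_left_comm, ← pow_add,
      Nat.sub_add_cancel (hyd l)]
  · rw [LinearMap.pi_apply]
    simp only [Φ, Fin.append_right]
    refine Subtype.ext ?_
    change 1 * frobProj p e (cc (Sum.inr l)) _ = _
    rw [AddEquiv.symm_apply_apply, hproj, one_mul]
    rfl

end Lower

/-! ### The limit -/

section Signature

theorem tendsto_div_of_linear_error {p : ℕ} (hp : 1 < p) (b : ℕ → ℕ) (σ K : ℝ)
    (hl : ∀ e, σ * ((p : ℝ) ^ e) ^ 2 - K * (p : ℝ) ^ e ≤ b e)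
    (hu : ∀ e, (b e : ℝ) ≤ σ * ((p : ℝ) ^ e) ^ 2 + K * (p : ℝ) ^ e) :
    Filter.Tendsto (fun e : ℕ => (b e : ℝ) / (p : ℝ) ^ (e * 2)) Filter.atTop (nhds σ) := by
  have hp' : (1 : ℝ) < p := by exact_mod_cast hp
  have h0 : Filter.Tendsto (fun e : ℕ => K * ((p : ℝ)⁻¹) ^ e) Filter.atTop (nhds 0) := by
    have := (tendsto_pow_atTop_nhds_zero_of_lt_one (r := (p : ℝ)⁻¹) (by positivity)
      (inv_lt_one_of_one_lt₀ hp')).const_mul K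
    simpa using this
  have hlow : Filter.Tendsto (fun e : ℕ => σ - K * ((p : ℝ)⁻¹) ^ e) Filter.atTop (nhds σ) := by
    simpa using h0.const_sub σ
  have hupp : Filter.Tendsto (fun e : ℕ => σ + K * ((p : ℝ)⁻¹) ^ e) Filter.atTop (nhds σ) := by
    simpa using h0.const_add σ
  refine tendsto_of_tendsto_of_tendsto_of_le_of_le hlow hupp (fun e => ?_) (fun e => ?_)
  · have hq : (0 : ℝ) < (p : ℝ) ^ e := by positivity
    simp only
    rw [pow_mul, le_div_iff₀ (by positivity), inv_pow]
    refine le_trans (le_of_eq ?_) (hl e)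
    field_simp
  · have hq : (0 : ℝ) < (p : ℝ) ^ e := by positivity
    simp only
    rw [pow_mul, div_le_iff₀ (by positivity), inv_pow]
    refine (hu e).trans (le_of_eq ?_)
    field_simp

theorem exists_isFSurjectiveNumber (R : Type*) [CommRing R] (p : ℕ) [ExpChar R p] (M : Type*)
    [AddCommGroup M] [Module R M] (e B : ℕ)
    (h : ∀ m, (∃ φ : FrobTwist p e M →ₗ[R] (Fin m → M), Function.Surjective φ) → m ≤ B) :
    ∃ b, IsFSurjectiveNumber R p M e b := by
  have hne : {m : ℕ | ∃ φ : FrobTwist p e M →ₗ[R] (Fin m → M), Function.Surjective φ}.Nonempty :=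
    ⟨0, 0, fun v => ⟨0, Subsingleton.elim _ _⟩⟩
  have hbdd : BddAbove {m : ℕ | ∃ φ : FrobTwist p e M →ₗ[R] (Fin m → M), Function.Surjective φ} :=
    ⟨B, fun m hm => h m hm⟩
  exact ⟨_, Nat.sSup_mem hne hbdd, fun m hm => le_csSup hbdd hm⟩

variable {k : Type*} [Field k] {p : ℕ} [Fact p.Prime] [CharP k p] {n a : ℕ} [NeZero n] {ζ : k}

/-- The square [0, q)² lies in both arms. It is given to the shorter one; the longer, one q shorter
without it, still has length at least min(i, j) q. -/
theorem exists_surjective_of_lt [PerfectRing k p] (hζ : IsPrimitiveRoot ζ n)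
    (hnp : Nat.Coprime n p) (hcop : Nat.Coprime a n) (e : ℕ) {i j : ℕ} (hi0 : 0 < i) (hin : i < n)
    (hjn : j < n) (hj : a * j ≡ i [MOD n])
    (hbox : ∀ u v, u + a * v ≡ i [MOD n] → i ≤ u ∨ j ≤ v) (hij : i ≠ j) :
    ∃ φ : FrobTwist p e (semiInv ζ a i) →ₗ[invRing ζ a]
      (Fin (min i j * p ^ e * (p ^ e / n) + p ^ e * (p ^ e / n)) → semiInv ζ a i),
      Function.Surjective φ := by
  have hn := NeZero.pos n
  have hE := le_card_wtFilter_fst hn hcop i (p ^ e) (Finset.Ico (i * p ^ e) ((i + 1) * p ^ e))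
  rw [Nat.card_Ico, show (i + 1) * p ^ e - i * p ^ e = p ^ e by
    rw [add_mul, one_mul, Nat.add_sub_cancel_left]] at hE
  rcases hij.lt_or_gt with h | h
  · refine exists_surjective_of_sources hζ hnp hcop hi0 hin hjn hj hbox (A := wtFilter n a i
      (Finset.range (i * p ^ e) ×ˢ Finset.range (p ^ e))) (B := wtFilter n a i
      (Finset.range (p ^ e) ×ˢ Finset.Ico (p ^ e) (j * p ^ e))) subset_rfl ?_ ?_ subset_rfl ?_ ?_ hE
    · intro c hc
      simp only [mem_wtFilter, Finset.mem_product, Finset.mem_range, Finset.mem_Ico] at hc ⊢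
      tauto
    · rw [Finset.disjoint_left]
      intro c hc hc'
      simp only [mem_wtFilter, Finset.mem_product, Finset.mem_range, Finset.mem_Ico] at hc hc'
      omega
    · rw [min_eq_left h.le]
      refine le_trans (le_of_eq ?_) (le_card_wtFilter_fst hn hcop i (p ^ e) _)
      rw [Finset.card_range]
    · rw [min_eq_left h.le]
      refine le_trans ?_ (le_card_wtFilter hn a i (p ^ e) _)
      rw [Nat.card_Ico, show j * p ^ e - p ^ e = (j - 1) * p ^ e by rw [Nat.sub_mul, one_mul]]
      exact Nat.mul_le_mul_right _ (Nat.mul_le_mul_right _ (by omega))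
  · refine exists_surjective_of_sources hζ hnp hcop hi0 hin hjn hj hbox (A := wtFilter n a i
      (Finset.Ico (p ^ e) (i * p ^ e) ×ˢ Finset.range (p ^ e))) (B := wtFilter n a i
      (Finset.range (p ^ e) ×ˢ Finset.range (j * p ^ e))) ?_ subset_rfl ?_ subset_rfl ?_ ?_ hE
    · intro c hc
      simp only [mem_wtFilter, Finset.mem_product, Finset.mem_range, Finset.mem_Ico] at hc ⊢
      tauto
    · rw [Finset.disjoint_left]
      intro c hc hc'
      simp only [mem_wtFilter, Finset.mem_product, Finset.mem_range, Finset.mem_Ico] at hc hc'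
      omega
    · rw [min_eq_right h.le]
      refine le_trans ?_ (le_card_wtFilter_fst hn hcop i (p ^ e) _)
      rw [Nat.card_Ico, show i * p ^ e - p ^ e = (i - 1) * p ^ e by rw [Nat.sub_mul, one_mul]]
      exact Nat.mul_le_mul_right _ (Nat.mul_le_mul_right _ (by omega))
    · rw [min_eq_right h.le]
      refine le_trans (le_of_eq ?_) (le_card_wtFilter hn a i (p ^ e) _)
      rw [Finset.card_range]

set_option synthInstance.maxHeartbeats 200000 in
-- The arms have equal length, so the common square is halved: F' goes to A and its complement to B.
theorem exists_surjective_of_eq [PerfectRing k p] (hζ : IsPrimitiveRoot ζ n)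
    (hnp : Nat.Coprime n p) (hcop : Nat.Coprime a n) (e : ℕ) {i : ℕ} (hi0 : 0 < i) (hin : i < n)
    (hj : a * i ≡ i [MOD n]) (hbox : ∀ u v, u + a * v ≡ i [MOD n] → i ≤ u ∨ i ≤ v) :
    ∃ φ : FrobTwist p e (semiInv ζ a i) →ₗ[invRing ζ a]
      (Fin ((i - 1) * p ^ e * (p ^ e / n) + p ^ e * (p ^ e / n) / 2 + p ^ e * (p ^ e / n)) →
        semiInv ζ a i), Function.Surjective φ := by
  classical
  have hn := NeZero.pos n
  have hE := le_card_wtFilter_fst hn hcop i (p ^ e) (Finset.Ico (i * p ^ e) ((i + 1) * p ^ e))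
  rw [Nat.card_Ico, show (i + 1) * p ^ e - i * p ^ e = p ^ e by
    rw [add_mul, one_mul, Nat.add_sub_cancel_left]] at hE
  have hF := le_card_wtFilter hn a i (p ^ e) (Finset.range (p ^ e))
  rw [Finset.card_range] at hF
  set F := wtFilter n a i (Finset.range (p ^ e) ×ˢ Finset.range (p ^ e)) with hFdef
  obtain ⟨F', hF', hcard⟩ := Finset.exists_subset_card_eq
    (show p ^ e * (p ^ e / n) / 2 ≤ F.card by omega)
  have hcard' : p ^ e * (p ^ e / n) / 2 ≤ (F \ F').card := by
    rw [Finset.card_sdiff_of_subset hF']; omega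
  have hle : p ^ e ≤ i * p ^ e := Nat.le_mul_of_pos_left _ hi0
  have hmem : ∀ c ∈ F, (c.1 < p ^ e ∧ c.2 < p ^ e) ∧ c.1 + a * c.2 ≡ i [MOD n] := by
    intro c hc
    simpa [hFdef, mem_wtFilter] using hc
  have hX := le_card_wtFilter_fst hn hcop i (p ^ e) (Finset.Ico (p ^ e) (i * p ^ e))
  have hY := le_card_wtFilter hn a i (p ^ e) (Finset.Ico (p ^ e) (i * p ^ e))
  rw [Nat.card_Ico, show i * p ^ e - p ^ e = (i - 1) * p ^ e by rw [Nat.sub_mul, one_mul]] at hX hY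
  refine exists_surjective_of_sources hζ hnp hcop hi0 hin hin hj hbox (A := wtFilter n a i
      (Finset.Ico (p ^ e) (i * p ^ e) ×ˢ Finset.range (p ^ e)) ∪ F') (B := wtFilter n a i
      (Finset.range (p ^ e) ×ˢ Finset.Ico (p ^ e) (i * p ^ e)) ∪ (F \ F')) ?_ ?_ ?_ subset_rfl ?_ ?_ hE
  · intro c hc
    rcases Finset.mem_union.1 hc with hc | hc
    · simp only [mem_wtFilter, Finset.mem_product, Finset.mem_range, Finset.mem_Ico] at hc ⊢
      tauto
    · obtain ⟨⟨h1, h2⟩, h3⟩ := hmem c (hF' hc)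
      simp only [mem_wtFilter, Finset.mem_product, Finset.mem_range]
      exact ⟨⟨h1.trans_le hle, h2⟩, h3⟩
  · intro c hc
    rcases Finset.mem_union.1 hc with hc | hc
    · simp only [mem_wtFilter, Finset.mem_product, Finset.mem_range, Finset.mem_Ico] at hc ⊢
      tauto
    · obtain ⟨⟨h1, h2⟩, h3⟩ := hmem c (Finset.mem_sdiff.1 hc).1
      simp only [mem_wtFilter, Finset.mem_product, Finset.mem_range]
      exact ⟨⟨h1, h2.trans_le hle⟩, h3⟩
  · rw [Finset.disjoint_left]
    intro c hc hc'
    rcases Finset.mem_union.1 hc with hc | hc <;> rcases Finset.mem_union.1 hc' with hc' | hc'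
    · simp only [mem_wtFilter, Finset.mem_product, Finset.mem_range, Finset.mem_Ico] at hc hc'
      omega
    · have := hmem c (Finset.mem_sdiff.1 hc').1
      simp only [mem_wtFilter, Finset.mem_product, Finset.mem_range, Finset.mem_Ico] at hc
      omega
    · have := hmem c (hF' hc)
      simp only [mem_wtFilter, Finset.mem_product, Finset.mem_range, Finset.mem_Ico] at hc'
      omega
    · exact (Finset.mem_sdiff.1 hc').2 hc
  · rw [Finset.card_union_of_disjoint, hcard]
    · omega
    · rw [Finset.disjoint_left]
      intro c hc hc'
      have := hmem c (hF' hc')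
      simp only [mem_wtFilter, Finset.mem_product, Finset.mem_range, Finset.mem_Ico] at hc
      omega
  · rw [Finset.card_union_of_disjoint]
    · omega
    · rw [Finset.disjoint_left]
      intro c hc hc'
      have := hmem c (Finset.mem_sdiff.1 hc').1
      simp only [mem_wtFilter, Finset.mem_product, Finset.mem_range, Finset.mem_Ico] at hc
      omega

theorem hasDualFSignature_semiInv [IsAlgClosed k] (hζ : IsPrimitiveRoot ζ n)
    (hnp : Nat.Coprime n p) (hcop : Nat.Coprime a n) {i j : ℕ} (hi0 : 0 < i) (hin : i < n)
    (hj0 : 0 < j) (hjn : j < n) (hj : a * j ≡ i [MOD n])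
    (hbox : ∀ u v, u + a * v ≡ i [MOD n] → i ≤ u ∨ j ≤ v) :
    HasDualFSignature (invRing ζ a) p (semiInv ζ a i)
      (if i = j then (2 * (i : ℝ) + 1) / (2 * (n : ℝ)) else ((min i j : ℕ) + 1 : ℝ) / (n : ℝ)) := by
  have hn := NeZero.pos n
  have hn' : (0 : ℝ) < n := by exact_mod_cast hn
  have hp : 1 < p := (Fact.out (p := p.Prime)).one_lt
  have hb : ∀ e, ∃ b, IsFSurjectiveNumber (invRing ζ a) p (semiInv ζ a i) e b := fun e =>
    exists_isFSurjectiveNumber (invRing ζ a) p (semiInv ζ a i) e _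
      fun m ⟨φ, hφ⟩ => le_of_surjective_fst hζ hcop φ hφ
  choose b hb using hb
  refine ⟨2, b, ringKrullDim_invRing hζ, hb, ?_⟩
  have hfloor : ∀ e, ((p ^ e / n : ℕ) : ℝ) ≤ (p : ℝ) ^ e / n ∧
      (p : ℝ) ^ e / n ≤ ((p ^ e / n : ℕ) : ℝ) + 1 := by
    intro e
    constructor
    · have := Nat.cast_div_le (α := ℝ) (m := p ^ e) (n := n)
      push_cast at this
      exact this
    · rw [div_le_iff₀ hn']
      have := (Nat.lt_div_mul_add (a := p ^ e) hn).le
      have h2 : ((p ^ e : ℕ) : ℝ) ≤ ((p ^ e / n * n + n : ℕ) : ℝ) := by exact_mod_cast this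
      push_cast at h2
      rw [add_mul, one_mul]
      exact h2
  have hq : ∀ e, (1 : ℝ) ≤ (p : ℝ) ^ e := fun e => one_le_pow₀ (by exact_mod_cast hp.le)
  split_ifs with hij
  · subst hij
    -- Rounding q/n costs at most (i + 1/2) q and halving the square at most 1/2, together at most
    -- (i + 1) q.
    refine tendsto_div_of_linear_error hp b _ ((i : ℝ) + 1) (fun e => ?_) (fun e => ?_)
    · have h1 := (hb e).2 (exists_surjective_of_eq hζ hnp hcop e hi0 hin hj hbox)
      have h2 : (2 * i + 1) * (p ^ e * (p ^ e / n)) ≤ 2 * b e + 1 := by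
        obtain ⟨l, rfl⟩ : ∃ l, i = l + 1 := ⟨i - 1, by omega⟩
        rw [Nat.add_sub_cancel, mul_assoc] at h1
        generalize p ^ e * (p ^ e / n) = N at *
        have h3 : (2 * (l + 1) + 1) * N = 2 * (l * N) + 3 * N := by ring
        omega
      have h3 : (2 * (i : ℝ) + 1) * ((p : ℝ) ^ e * ((p ^ e / n : ℕ) : ℝ)) ≤ 2 * b e + 1 := by
        exact_mod_cast h2
      obtain ⟨-, h4⟩ := hfloor e
      have h5 : (2 * (i : ℝ) + 1) * ((p : ℝ) ^ e * ((p : ℝ) ^ e / n - 1)) ≤ 2 * b e + 1 :=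
        le_trans (by gcongr; linarith) h3
      have h6 : (2 * (i : ℝ) + 1) * ((p : ℝ) ^ e * ((p : ℝ) ^ e / n - 1)) =
          2 * ((2 * (i : ℝ) + 1) / (2 * n) * ((p : ℝ) ^ e) ^ 2) - (2 * (i : ℝ) + 1) * (p : ℝ) ^ e := by
        field_simp
      have := hq e
      rw [h6] at h5
      linarith
    · obtain ⟨φ, hφ⟩ := (hb e).1
      have h1 := two_mul_le_of_surjective hζ hcop hi0 hj0 hj φ hφ
      have h2 : (b e : ℝ) * 2 ≤ ((i : ℝ) + i + 1) * (p : ℝ) ^ e * (((p ^ e / n : ℕ) : ℝ) + 1) := by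
        exact_mod_cast h1
      obtain ⟨h4, -⟩ := hfloor e
      have h5 : (b e : ℝ) * 2 ≤ ((i : ℝ) + i + 1) * (p : ℝ) ^ e * ((p : ℝ) ^ e / n + 1) :=
        h2.trans (by gcongr)
      have h6 : ((i : ℝ) + i + 1) * (p : ℝ) ^ e * ((p : ℝ) ^ e / n + 1) =
          2 * ((2 * (i : ℝ) + 1) / (2 * n) * ((p : ℝ) ^ e) ^ 2) + (2 * (i : ℝ) + 1) * (p : ℝ) ^ e := by
        field_simp
        ring
      have := hq e
      rw [h6] at h5
      linarith
  · refine tendsto_div_of_linear_error hp b _ ((min i j : ℕ) + 1 : ℝ) (fun e => ?_) (fun e => ?_)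
    · have h1 := (hb e).2 (exists_surjective_of_lt hζ hnp hcop e hi0 hin hjn hj hbox hij)
      generalize min i j = l at *
      have h3 : ((l : ℝ) + 1) * ((p : ℝ) ^ e * ((p ^ e / n : ℕ) : ℝ)) ≤ b e := by
        refine le_trans (le_of_eq ?_) (Nat.cast_le.2 h1)
        push_cast
        ring
      obtain ⟨-, h4⟩ := hfloor e
      have h5 : ((l : ℝ) + 1) * ((p : ℝ) ^ e * ((p : ℝ) ^ e / n - 1)) ≤ b e :=
        le_trans (by gcongr; linarith) h3
      refine le_trans (le_of_eq ?_) h5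
      field_simp
    · obtain ⟨φ, hφ⟩ := (hb e).1
      have h1 : b e ≤ (min i j + 1) * p ^ e * (p ^ e / n + 1) := by
        rcases min_cases i j with ⟨h, -⟩ | ⟨h, -⟩ <;> rw [h]
        · exact le_of_surjective_fst hζ hcop φ hφ
        · exact le_of_surjective_snd hζ hcop hj φ hφ
      generalize min i j = l at *
      have h2 : (b e : ℝ) ≤ ((l : ℝ) + 1) * (p : ℝ) ^ e * (((p ^ e / n : ℕ) : ℝ) + 1) := by
        exact_mod_cast h1
      obtain ⟨h4, -⟩ := hfloor e
      have h5 : (b e : ℝ) ≤ ((l : ℝ) + 1) * (p : ℝ) ^ e * ((p : ℝ) ^ e / n + 1) :=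
        h2.trans (by gcongr)
      refine h5.trans (le_of_eq ?_)
      field_simp

end Signature
end DualFSig
end

theorem theorem3p5 {k : Type*} [Field k] [IsAlgClosed k] (p : ℕ) [Fact p.Prime] [CharP k p]
    (n a : ℕ) (ha : 1 ≤ a) (han : a < n) (hcop : Nat.Coprime a n) (hnp : Nat.Coprime n p)
    (ζ : k) (hζ : IsPrimitiveRoot ζ n) (α : List ℕ) (hα : DualFSig.IsHJExpansion n a α) :
    -- every `M_{i_t}` with `1 ≤ t ≤ r` is `R x^{i_t} + R y^{j_t}`, is a non-free indecomposable
    -- special module, and has the asserted dual F-signature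
    (∀ t : ℕ, 1 ≤ t → t ≤ α.length →
      ∃ i j : ℕ, DualFSig.iSeries n a α t = (i : ℤ) ∧ DualFSig.jSeries α t = (j : ℤ) ∧
        DualFSig.semiInv ζ a i = Submodule.span (DualFSig.invRing ζ a)
          {(MvPowerSeries.X 0 ^ i : DualFSig.PS k), (MvPowerSeries.X 1 ^ j : DualFSig.PS k)} ∧
        DualFSig.IsSpecial (DualFSig.invRing ζ a) (DualFSig.canonicalModule ζ a)
          (DualFSig.semiInv ζ a i) ∧
        DualFSig.IsIndecomposable (DualFSig.invRing ζ a) (DualFSig.semiInv ζ a i) ∧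
        ¬ Module.Free (DualFSig.invRing ζ a) (DualFSig.semiInv ζ a i) ∧
        DualFSig.HasDualFSignature (DualFSig.invRing ζ a) p (DualFSig.semiInv ζ a i)
          (if i = j then (2 * (i : ℝ) + 1) / (2 * (n : ℝ)) else ((min i j : ℕ) + 1 : ℝ) / (n : ℝ))) ∧
    -- every non-free special module among the modules `M_s` is one of the `M_{i_t}`
    (∀ s : ℕ, s < n →
      DualFSig.IsSpecial (DualFSig.invRing ζ a) (DualFSig.canonicalModule ζ a)
        (DualFSig.semiInv ζ a s) →
      ¬ Module.Free (DualFSig.invRing ζ a) (DualFSig.semiInv ζ a s) →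
      ∃ t : ℕ, 1 ≤ t ∧ t ≤ α.length ∧ DualFSig.iSeries n a α t = (s : ℤ)) := by
  have : NeZero n := ⟨by omega⟩
  have hn := NeZero.pos n
  refine ⟨fun t ht1 ht => ?_, fun s hs hspec hfree =>
    DualFSig.exists_iSeries_eq_of_isSpecial hζ hα ha hcop hs hspec hfree⟩
  obtain ⟨hi0, hin, hj0, hjn⟩ := DualFSig.iSeries_jSeries_bounds hα hn ha ht1 ht
  obtain ⟨i, hi⟩ := Int.eq_ofNat_of_zero_le (a := DualFSig.iSeries n a α t) (by omega)
  obtain ⟨j, hj⟩ := Int.eq_ofNat_of_zero_le (a := DualFSig.jSeries α t) (by omega)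
  have haj := DualFSig.modEq_of_dvd_series hi hj
  have hbox : ∀ u v, u + a * v ≡ i [MOD n] → i ≤ u ∨ j ≤ v := fun u v h =>
    DualFSig.le_or_le_of_modEq hα hn ha ht hi hj h
  have hi0n : ¬ i ≡ 0 [MOD n] := fun h => by
    have := Nat.ModEq.eq_of_lt_of_lt h (by omega) hn
    omega
  exact ⟨i, j, hi, hj, DualFSig.semiInv_eq_span hζ haj hbox,
    DualFSig.isSpecial_of_support hζ haj fun u v h =>
      DualFSig.le_or_le_of_modEq_succ hα hn ha hcop ht1 ht hi hj h,
    DualFSig.isIndecomposable_semiInv hζ i, DualFSig.not_free_semiInv hζ hi0n haj,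
    DualFSig.hasDualFSignature_semiInv hζ hnp hcop (by omega) (by omega) (by omega) (by omega)
      haj hbox⟩
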